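/- **Conventions.** An $\mathbb F_1$-algebra is a commutative monoid with zero. An admissible $\mathbb F_1$-algebra is an $\mathbb F_1$-algebra $A$ with a linear topology (a family of open ideals) that is Hausdorff, i.e. the open ideals have intersection $\{0\}$, and is generated by the powers of some finitely generated ideal. The formal spectrum $\operatorname{Spec}A$ is the set of open prime ideals of $A$, with the topology generated by the sets $D(f)=\{\mathfrak p\mid f\notin\mathfrak p\}$. A formal $\mathbb F_1$-scheme is a locally representable presheaf on the category of affine formal schemes $\operatorname{Spec}A$ (the opposite of the category of admissible algebras and continuous homomorphisms), that is, a presheaf that is the union of affine open subobjects; it has an underlying topological space, glued from formal spectra. It is a scheme if it is a union of affine opens with discrete coordinate algebras. A marked scheme $(Y,Z)$ is a scheme $Y$ with a subset $Z$ which is locally the vanishing set of finitely many functions. Its formal completion $\hat Y_Z$ is the formal scheme for which morphisms $T\to\hat Y_Z$ are the morphisms $T\to Y$ that map $T$ set-theoretically into $Z$. A formal scheme is algebraisable if it is isomorphic to $\hat Y_Z$ for some marked scheme $(Y,Z)$. A covering space of $X$ is a morphism of formal schemes $\pi:Y\to X$ such that each point of $X$ has an open neighbourhood $V$ for which $\pi^{-1}(V)$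 is isomorphic over $V$ to a nonempty disjoint union of copies of $V$. A formal $\mathbb F_1$-scheme $X$ is integral if for every nonempty affine open $U\subseteq X$ the set $\mathcal O(U)\setminus\{0\}$ is a cancellative monoid, and for all nonempty affine opens $U'\subseteq U$ the inclusion is non-boundary, i.e. no nonzero element of $\mathcal O(U)$ restricts to zero in $\mathcal O(U')$. For such $X$, let $K_X^\times$ be the sheaf of abelian groups on $X$ whose sections on a nonempty affine open $U$ form the group completion of $\mathcal O(U)\setminus\{0\}$. **Corollary.** Let $X$ be an integral formal $\mathbb F_1$-scheme. Then $K_X^\times$ is a locally constant sheaf, so for each point $x$ of $X$ the monodromy of $K_X^\times$ (transport of germs along loops) is an action $$\rho_x:\pi_1(X,x)\to\operatorname{Aut}(K_{X,x}^\times)$$ by group automorphisms, and $X$ admits a covering space $\pi:Y\to X$ such that: 1. $Y$ is algebraisable; 2. $\pi$ induces a bijection between the sets of connected components of $Y$ and of $X$, and for every point $y$ of $Y$ the image of $\pi_*:\pi_1(Y,y)\to\pi_1(X,\pi(y))$ is the kernel of $\rho_{\pi(y)}$; that is, over each connected component of $X$, $Y$ is the connected covering space corresponding to the kernel of the monodromy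 action; 3. $Y$ is integral, and $K_Y^\times$ is a constant sheaf on each connected component of $Y$. -/

import Mathlib

open CategoryTheory TopologicalSpace Opposite

universe u

namespace FOne

/-- An ideal of an `𝔽₁`-algebra (a commutative monoid with zero). -/
def IsIdeal {A : Type*} [CommMonoidWithZero A] (I : Set A) : Prop :=
  0 ∈ I ∧ ∀ a x : A, x ∈ I → a * x ∈ I

/-- A nonzero admissible `𝔽₁`-algebra: a commutative monoid with zero, `0 ≠ 1`, with a linear
topology, recorded by its family of open ideals, that is Hausdorff and is generated by the powers
of a finitely generated ideal of definition. (The last condition says that an ideal is open exactly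
when it contains all products of `n` elements of a fixed finite set `S`, for some `n`; the product
of two open ideals is then open.) The zero algebra, whose spectrum is empty, is left out: the empty
formal scheme is covered by the empty family, so it is not needed as a test object. -/
structure AdmAlg : Type (u + 1) where
  carrier : Type u
  [commMonoidWithZero : CommMonoidWithZero carrier]
  [nontrivial : Nontrivial carrier]
  openIdeals : Set (Set carrier)
  exists_ideal_of_definition : ∃ S : Finset carrier, ∀ I : Set carrier,
    I ∈ openIdeals ↔
      IsIdeal I ∧ ∃ n : ℕ, ∀ s : Fin n → carrier, (∀ i, s i ∈ S) → ∏ i, s i ∈ I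
  hausdorff : ∀ a : carrier, (∀ I ∈ openIdeals, a ∈ I) → a = 0

instance : CoeSort AdmAlg.{u} (Type u) := ⟨AdmAlg.carrier⟩

attribute [instance] AdmAlg.commMonoidWithZero AdmAlg.nontrivial

/-- Continuous homomorphisms of admissible `𝔽₁`-algebras. -/
@[ext]
structure AdmAlg.Hom (A B : AdmAlg.{u}) : Type u where
  toHom : A →*₀ B
  continuous : ∀ I ∈ B.openIdeals, toHom ⁻¹' I ∈ A.openIdeals

instance : Category.{u} AdmAlg.{u} where
  Hom := AdmAlg.Hom
  id A := ⟨MonoidWithZeroHom.id A, fun _ hI => hI⟩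
  comp f g := ⟨g.toHom.comp f.toHom, fun I hI => f.continuous _ (g.continuous I hI)⟩

/-- The map underlying a continuous homomorphism. -/
def AdmAlg.ev {A B : AdmAlg.{u}} (φ : A ⟶ B) : A →*₀ B := AdmAlg.Hom.toHom φ

/-- The topology is discrete: the zero ideal is open. -/
def AdmAlg.IsDiscrete (A : AdmAlg.{u}) : Prop := ({0} : Set A) ∈ A.openIdeals

/-- A nonzero `𝔽₁`-algebra with the discrete topology. -/
def AdmAlg.disc (R : Type u) [CommMonoidWithZero R] [Nontrivial R] : AdmAlg.{u} where
  carrier := R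
  openIdeals := {I | IsIdeal I}
  exists_ideal_of_definition :=
    ⟨∅, fun _ => ⟨fun h => ⟨h, 1, fun s hs => absurd (hs 0) (by simp)⟩, fun h => h.1⟩⟩
  hausdorff a h := by
    have := h {0} ⟨rfl, by rintro b x (rfl : x = 0); exact mul_zero b⟩
    exact this

/-- The discrete `𝔽₁`-field `𝔽₁ = {0, 1}`. -/
def pt : AdmAlg.{u} := AdmAlg.disc (WithZero PUnit.{u + 1})

/-- Presheaves on the category of (nonempty) affine formal `𝔽₁`-schemes, the opposite of
`AdmAlg`. As affine formal `𝔽₁`-schemes have no nontrivial coverings, these are the sheaves. -/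
abbrev FPsh : Type (u + 1) := AdmAlg.{u} ⥤ Type u

/-- The points of the formal spectrum of `A`. An open prime ideal `𝔭` of `A` is the same as a
continuous homomorphism `A ⟶ 𝔽₁`: the one that sends `𝔭` to `0` and its complement to `1`. -/
abbrev Prime (A : AdmAlg.{u}) : Type u := A ⟶ pt.{u}

/-- The topology of the formal spectrum of `A`, generated by the sets `D(f) = {𝔭 | f ∉ 𝔭}`. -/
@[reducible]
def zariski (A : AdmAlg.{u}) : TopologicalSpace (Prime A) :=
  TopologicalSpace.generateFrom {D | ∃ f : A, D = {𝔭 | AdmAlg.ev 𝔭 f ≠ 0}}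

/-- The underlying set of points of `X`. -/
def Pt (X : FPsh.{u}) : Type u := X.obj pt

/-- The image of a point of the formal spectrum of `A` under the morphism `Spec A → X` given by
`x ∈ X(A)`. -/
def imagePt {X : FPsh.{u}} {A : AdmAlg.{u}} (x : X.obj A) (𝔭 : Prime A) : Pt X := X.map 𝔭 x

/-- The topology on the points of `X`: a set is open when its preimage in the formal spectrum of
`A` is open for every affine formal scheme `Spec A` over `X`. -/
instance (X : FPsh.{u}) : TopologicalSpace (Pt X) :=
  ⨆ (A : AdmAlg.{u}) (x : X.obj A), (zariski A).coinduced (imagePt x)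

/-- The underlying topological space of `X`. -/
abbrev space (X : FPsh.{u}) : TopCat.{u} := TopCat.of (Pt X)

/-- The subfunctor of those `Spec B → X` that factor set-theoretically through `V`. -/
def supported (X : FPsh.{u}) (V : Set (Pt X)) : Subfunctor X where
  obj B := {y | ∀ 𝔭 : Prime B, imagePt y 𝔭 ∈ V}
  map φ y hy 𝔭 := by
    have := hy (φ ≫ 𝔭)
    rwa [imagePt, X.map_comp] at this

/-- The morphism `Spec A → X` given by `a ∈ X(A)` is an open immersion with image the open
subset `V`. -/
def IsAffineChart {X : FPsh.{u}} {A : AdmAlg.{u}} (a : X.obj A) (V : Opens (Pt X)) : Prop :=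
  (∀ B : AdmAlg.{u}, Function.Injective (fun φ : A ⟶ B => X.map φ a)) ∧
    ∀ (B : AdmAlg.{u}) (y : X.obj B),
      (∃ φ : A ⟶ B, X.map φ a = y) ↔ y ∈ (supported X V).obj B

/-- A formal `𝔽₁`-scheme is a locally representable presheaf on affine formal `𝔽₁`-schemes: it is
the union of its affine open subobjects. -/
def IsFormalScheme (X : FPsh.{u}) : Prop :=
  ∀ (B : AdmAlg.{u}) (y : X.obj B), ∃ (A : AdmAlg.{u}) (a : X.obj A) (V : Opens (Pt X)),
    IsAffineChart a V ∧ y ∈ (supported X V).obj B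

/-- An `𝔽₁`-scheme is a formal `𝔽₁`-scheme that is the union of affine open subobjects with
discrete coordinate algebra. -/
def IsScheme (X : FPsh.{u}) : Prop :=
  ∀ (B : AdmAlg.{u}) (y : X.obj B), ∃ (A : AdmAlg.{u}) (a : X.obj A) (V : Opens (Pt X)),
    A.IsDiscrete ∧ IsAffineChart a V ∧ y ∈ (supported X V).obj B

/-- `Z` is, locally on `Y`, the underlying set of a finitely presented closed subscheme, that is, of
the vanishing locus of finitely many functions. -/
def IsMarking (Y : FPsh.{u}) (Z : Set (Pt Y)) : Prop :=
  ∀ (B : AdmAlg.{u}) (y : Y.obj B), ∃ S : Finset B,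
    ∀ 𝔭 : Prime B, imagePt y 𝔭 ∈ Z ↔ ∀ s ∈ S, AdmAlg.ev 𝔭 s = 0

/-- The formal completion of `Y` along `Z`. Morphisms from a formal scheme `T` into it are the
morphisms from `T` to `Y` that map all of `T` into `Z` set-theoretically. -/
abbrev completion (Y : FPsh.{u}) (Z : Set (Pt Y)) : FPsh.{u} := (supported Y Z).toFunctor

/-- `X` is isomorphic to the formal completion of a marked scheme `(Y, Z)`. -/
def IsAlgebraisable (X : FPsh.{u}) : Prop :=
  ∃ (Y : FPsh.{u}) (Z : Set (Pt Y)), IsScheme Y ∧ IsMarking Y Z ∧ Nonempty (X ≅ completion Y Z)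

/-- `π : Y ⟶ X` is a covering space: each point of `X` has an open neighbourhood `V` over which `Y`
is isomorphic to a nonempty disjoint union of copies of `V`. (The `s i` are the inclusions of the
copies; as affine formal `𝔽₁`-schemes are connected, disjoint unions are computed pointwise.) -/
def IsCoveringSpace {Y X : FPsh.{u}} (π : Y ⟶ X) : Prop :=
  ∀ x : Pt X, ∃ V : Opens (Pt X), x ∈ V ∧
    ∃ (F : Type u) (_ : Nonempty F) (s : F → ((supported X V).toFunctor ⟶ Y)),
      (∀ i, s i ≫ π = (supported X V).ι) ∧
      ∀ (B : AdmAlg.{u}) (y : Y.obj B) (hy : π.app B y ∈ (supported X V).obj B),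
        ∃! i, (s i).app B ⟨π.app B y, hy⟩ = y

/-- The map on points underlying a morphism. -/
def onPt {Y X : FPsh.{u}} (π : Y ⟶ X) : Pt Y → Pt X := π.app pt

/-- The continuous map underlying a morphism. -/
def mapPt {Y X : FPsh.{u}} (π : Y ⟶ X) : C(Pt Y, Pt X) where
  toFun := onPt π
  continuous_toFun := by
    refine continuous_iSup_dom.2 fun A => continuous_iSup_dom.2 fun y =>
      continuous_coinduced_dom.2 ?_
    have h : onPt π ∘ imagePt y = imagePt (π.app A y) :=
      funext fun 𝔭 => NatTrans.naturality_apply π 𝔭 y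
    rw [h]
    exact continuous_iSup_rng (i := A) (continuous_iSup_rng (i := π.app A y)
      continuous_coinduced_rng)

/-- A formal scheme `X` is integral: the nonzero elements of the coordinate algebra of each nonempty
affine open subset form a cancellative monoid, and the inclusion of a nonempty affine open subset
into another one is a non-boundary morphism, that is, the restriction map has zero kernel. (The
second condition is automatic for schemes and in the locally Noetherian case; it is what makes the
fraction fields of the coordinate algebras into a sheaf on `X`.) -/
structure IsIntegral (X : FPsh.{u}) : Prop where
  cancel : ∀ {A : AdmAlg.{u}} {a : X.obj A} {V : Opens (Pt X)}, IsAffineChart a V →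
    IsCancelMulZero A
  nonboundary : ∀ {A B : AdmAlg.{u}} {a : X.obj A} {b : X.obj B} {V W : Opens (Pt X)},
    IsAffineChart a V → IsAffineChart b W → ∀ φ : A ⟶ B, X.map φ a = b →
      ∀ f : A, AdmAlg.ev φ f = 0 → f = 0

/-- The nonempty affine open subsets of `X`. -/
def AffineOpens (X : FPsh.{u}) : Type u :=
  {V : Opens (Pt X) // ∃ (A : AdmAlg.{u}) (a : X.obj A), IsAffineChart a V}

namespace AffineOpens

variable {X : FPsh.{u}}

/-- The coordinate algebra of an affine open subset. -/
noncomputable def ring (V : AffineOpens X) : AdmAlg.{u} := V.2.choose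

/-- The inclusion of an affine open subset, as a point of `X` with values in its coordinate
algebra. -/
noncomputable def incl (V : AffineOpens X) : X.obj V.ring := V.2.choose_spec.choose

theorem isAffineChart (V : AffineOpens X) : IsAffineChart V.incl V.1 :=
  V.2.choose_spec.choose_spec

theorem exists_res {V W : AffineOpens X} (h : V.1 ≤ W.1) :
    ∃ φ : W.ring ⟶ V.ring, X.map φ W.incl = V.incl := by
  rw [W.isAffineChart.2]
  intro 𝔭
  exact h (((V.isAffineChart.2 _ V.incl).1 ⟨𝟙 _, by simp⟩) 𝔭)

/-- Restriction of functions between affine open subsets. -/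
noncomputable def res {V W : AffineOpens X} (h : V.1 ≤ W.1) : W.ring ⟶ V.ring :=
  (exists_res h).choose

theorem map_res {V W : AffineOpens X} (h : V.1 ≤ W.1) : X.map (res h) W.incl = V.incl :=
  (exists_res h).choose_spec

end AffineOpens

/-- The group `K_A^×` of invertible elements of the fraction field of an integral `𝔽₁`-algebra
`A`: the group completion of the monoid of nonzero elements of `A`. -/
abbrev FracGroup (A : AdmAlg.{u}) : Type u := Algebra.GrothendieckGroup (nonZeroDivisors A)

section CharacterSheaf

variable {X : FPsh.{u}} (hX : IsIntegral X)

/-- Restriction of nonzero functions between nonempty affine open subsets. -/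
noncomputable def nzRes {V W : AffineOpens X} (h : V.1 ≤ W.1) :
    nonZeroDivisors W.ring →* nonZeroDivisors V.ring :=
  ((AdmAlg.ev (AffineOpens.res h) : W.ring →* V.ring).comp
    (nonZeroDivisors W.ring).subtype).codRestrict _ fun f => by
      have := hX.cancel V.isAffineChart
      refine mem_nonZeroDivisors_of_ne_zero fun hf => ?_
      exact nonZeroDivisors.coe_ne_zero f
        (hX.nonboundary W.isAffineChart V.isAffineChart _ (AffineOpens.map_res h) _ hf)

/-- The restriction map `K_{O(W)}^× → K_{O(V)}^×` between nonempty affine open subsets `V ≤ W`. -/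
noncomputable def fracRes {V W : AffineOpens X} (h : V.1 ≤ W.1) :
    FracGroup W.ring →* FracGroup V.ring :=
  Algebra.GrothendieckGroup.lift (Algebra.GrothendieckGroup.of.comp (nzRes hX h))

/-- Sections of `K_X^×` over an open subset `U`: families of elements of `K_{O(W)}^×` for the
nonempty affine open subsets `W ≤ U` that are compatible with restriction. -/
noncomputable def charSections (U : Opens (Pt X)) :
    Subgroup (∀ W : {W : AffineOpens X // W.1 ≤ U}, FracGroup W.1.ring) where
  carrier := {s | ∀ (V W : {W : AffineOpens X // W.1 ≤ U}) (h : V.1.1 ≤ W.1.1),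
    fracRes hX h (s W) = s V}
  one_mem' _ _ _ := map_one _
  mul_mem' {s t} hs ht V W h := by
    change fracRes hX h (s W * t W) = s V * t V
    rw [map_mul, hs V W h, ht V W h]
  inv_mem' {s} hs V W h := by
    change fracRes hX h (s W)⁻¹ = (s V)⁻¹
    rw [map_inv, hs V W h]

/-- The sheaf `K_X^×` on the underlying space of an integral formal scheme `X`. -/
noncomputable def charSheaf : TopCat.Presheaf CommGrpCat.{u} (space X) where
  obj U := CommGrpCat.of (charSections hX U.unop)
  map {U U'} i := CommGrpCat.ofHom
    { toFun := fun s => ⟨fun W => s.1 ⟨W.1, W.2.trans i.unop.le⟩, fun V W h =>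
        s.2 ⟨V.1, V.2.trans i.unop.le⟩ ⟨W.1, W.2.trans i.unop.le⟩ h⟩
      map_one' := rfl
      map_mul' := fun _ _ => rfl }

end CharacterSheaf

section Monodromy

instance : Limits.HasColimits CommGrpCat.{u} :=
  Adjunction.has_colimits_of_equivalence commGroupAddCommGroupEquivalence.functor

variable {T : TopCat.{u}} (F : TopCat.Presheaf CommGrpCat.{u} T)

/-- The restriction of `F` to the open set `U` is a constant sheaf with value `F(U)`: every germ at
a point of `U` extends uniquely to a section over `U`. -/
def IsConstantOn (U : Opens T) : Prop :=
  ∀ (x : T) (hx : x ∈ U), Function.Bijective (F.germ U x hx)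

/-- `F` is locally constant, i.e. a local system. -/
def IsLocalSystem : Prop := ∀ x : T, ∃ U : Opens T, x ∈ U ∧ IsConstantOn F U

variable {F}

/-- `ρ` is the monodromy action of the fundamental group at `x` on the stalk at `x` of a local
system: loops act on germs by path lifting in the étalé space. -/
def IsMonodromyAction (hF : IsLocalSystem F) (x : T)
    (ρ : FundamentalGroup T x →* MulAut (F.stalk x)) : Prop :=
  ∀ (γ : FundamentalGroup T x) (k : F.stalk x),
    (TopCat.Presheaf.EtaleSpace.isCoveringMap_base hF).monodromyPerm x γ ⟨⟨x, k⟩, rfl⟩ =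
      ⟨⟨x, ρ γ k⟩, rfl⟩

end Monodromy

end FOne

/-! A monoid with zero is local: its nonunits form a prime ideal. Hence every formal spectrum has a
closed point whose only open neighbourhood is the whole space. Three facts follow: affine opens are
path connected, every covering of the underlying space is trivial over each of them
(`IsAffineChart.isGood`), and an affine open inside another one is a basic open `D(f)`, so that
restriction is a completed localisation (`IsAffineChart.exists_isLoc`). Such a localisation inverts
`f` and then collapses the closure of zero. For integral `X` the non-boundary condition excludes the
collapse, so the fraction group does not change (`IsLoc.bijective_fracMap`). This makes `K_X^×`
constant on each chart, and its étalé space `E` a covering of the space of `X`.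

The space of `Y` is the holonomy covering of `E`. A point of it is a point `x` with a bijection from
the fibre of `E` at `x` to the fibre at a chosen base point, obtained by parallel transport. A loop
lifts to a closed path exactly when transport along it is the identity on the fibre, which gives the
kernel of the monodromy (`TrivCover.range_map`). No universal covering is needed. The formal scheme
`Y` is the fibre product of `X` with this covering, and has the same local charts as `X`. Evaluating
the bijection on germs sends the fraction groups of all affine opens of `Y` injectively into the one
set `E`, compatibly with restriction. This is a `CharTriv`, and it makes `K_Y^×` constant on
connected open sets.

A `CharTriv` also gives algebraisability. Glue the spectra of the coordinate algebras taken with the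
discrete topology. In general a loop of charts could glue a chart to itself nontrivially. With all
fractions lying in a single set, a `B`-point of the glued object has a well-defined partial function
from that set to `B`, its `graph`, and this determines the homomorphism on each chart. So the charts
embed, and they are open. A homomorphism from a coordinate algebra is continuous exactly when the
finitely many generators of the ideal of definition go into every open prime, so the original formal
scheme is the completion along the locus where they vanish. -/

namespace FOne

/-! ### The holonomy covering attached to a covering map -/

section TrivializingCover

open Set Filter Topology

variable {T E : Type u} [TopologicalSpace T] [TopologicalSpace E] {p : E → T}

/-- `σ` is a continuous section of `p` over `U`. -/
def IsSectionOn (p : E → T) (U : Set T) (σ : T → E) : Prop :=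
  ContinuousOn σ U ∧ ∀ x ∈ U, p (σ x) = x

/-- A path-connected open set over which `p` is trivial. -/
structure IsGood (p : E → T) (U : Set T) : Prop where
  isOpen : IsOpen U
  isPathConnected : IsPathConnected U
  exists_section : ∀ e, p e ∈ U → ∃ σ, IsSectionOn p U σ ∧ σ (p e) = e

theorem IsSectionOn.mono {U V : Set T} {σ : T → E} (h : IsSectionOn p U σ) (hV : V ⊆ U) :
    IsSectionOn p V σ :=
  ⟨h.1.mono hV, fun x hx => h.2 x (hV hx)⟩

/-- Parallel transport along a path in `U` maps a section over `U` to itself. -/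
theorem IsSectionOn.monodromy_eq (cov : IsCoveringMap p) {U : Set T} {σ : T → E}
    (h : IsSectionOn p U σ) {x y : T} (γ : Path x y) (hγ : ∀ t, γ t ∈ U) (e : p ⁻¹' {x})
    (he : σ x = e) : (cov.monodromy (.mk γ) e).1 = σ y := by
  have h0 : γ 0 = p e.1 := γ.source.trans e.2.symm
  have : (fun t => σ (γ t)) = cov.liftPath γ e.1 h0 := by
    rw [cov.eq_liftPath_iff]
    refine ⟨h.1.comp_continuous γ.continuous hγ, funext fun t => h.2 _ (hγ t), ?_⟩
    simp [he]
  change cov.liftPath γ e.1 h0 1 = σ y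
  rw [← this]
  simp

/-- The chosen base points, one in each path component. -/
def IsBase (z : T) : Prop := (Quotient.mk (pathSetoid T) z).out = z

theorem exists_isBase (x : T) : ∃ z, IsBase z ∧ Joined x z := by
  refine ⟨(Quotient.mk (pathSetoid T) x).out, ?_, ?_⟩
  · unfold IsBase
    rw [Quotient.out_eq]
  · exact (Quotient.exact (Quotient.out_eq (Quotient.mk (pathSetoid T) x))).symm

theorem IsBase.eq {z w : T} (hz : IsBase z) (hw : IsBase w) (h : Joined z w) : z = w := by
  unfold IsBase at hz hw
  have : Quotient.mk (pathSetoid T) z = Quotient.mk (pathSetoid T) w := Quotient.sound h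
  rw [← hz, ← hw, this]

/-- The total space of the covering that trivialises the covering `p`: pairs of a point `x` and an
identification of the fibre at `x` with the fibre at a base point, by transport along a path. -/
structure TrivCover (cov : IsCoveringMap p) : Type u where
  pt : T
  toFun : p ⁻¹' {pt} → E
  exists_path : ∃ z, IsBase z ∧ ∃ γ : Path.Homotopic.Quotient pt z,
    ∀ e, toFun e = (cov.monodromy γ e).1

namespace TrivCover

variable {cov : IsCoveringMap p}

theorem injective (θ : TrivCover cov) : Function.Injective θ.toFun := by
  obtain ⟨z, -, γ, h⟩ := θ.exists_path
  intro e e' hee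
  rw [h, h] at hee
  exact (cov.monodromy_bijective γ).1 (Subtype.ext hee)

theorem ext' {θ θ' : TrivCover cov} (h : θ.pt = θ'.pt)
    (h' : ∀ (e : E) (he : p e = θ.pt) (he' : p e = θ'.pt), θ.toFun ⟨e, he⟩ = θ'.toFun ⟨e, he'⟩) :
    θ = θ' := by
  obtain ⟨x, τ, _⟩ := θ
  obtain ⟨x', τ', _⟩ := θ'
  obtain rfl : x = x' := h
  obtain rfl : τ = τ' := funext fun e => h' e.1 e.2 e.2
  rfl

theorem toFun_congr {θ θ' : TrivCover cov} (h : θ = θ') {e e' : E} (h' : e = e')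
    {he : p e = θ.pt} {he' : p e' = θ'.pt} : θ.toFun ⟨e, he⟩ = θ'.toFun ⟨e', he'⟩ := by
  subst h h'; rfl

/-- `θ'` is obtained from `θ` by parallel transport inside `U`. -/
def Rel (U : Set T) (θ θ' : TrivCover cov) : Prop :=
  ∀ (σ : T → E), IsSectionOn p U σ → ∀ (h : p (σ θ.pt) = θ.pt) (h' : p (σ θ'.pt) = θ'.pt),
    θ.toFun ⟨σ θ.pt, h⟩ = θ'.toFun ⟨σ θ'.pt, h'⟩

theorem Rel.refl (U : Set T) (θ : TrivCover cov) : Rel U θ θ := fun _ _ _ _ => rfl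

theorem Rel.symm {U : Set T} {θ θ' : TrivCover cov} (h : Rel U θ θ') : Rel U θ' θ :=
  fun σ hσ h1 h2 => (h σ hσ h2 h1).symm

theorem Rel.trans {U : Set T} {θ θ' θ'' : TrivCover cov} (h : Rel U θ θ') (h' : Rel U θ' θ'')
    (hU : θ'.pt ∈ U) : Rel U θ θ'' :=
  fun σ hσ h1 h2 => (h σ hσ h1 (hσ.2 _ hU)).trans (h' σ hσ _ h2)

theorem Rel.mono {U V : Set T} {θ θ' : TrivCover cov} (h : Rel V θ θ') (hV : V ⊆ U) :
    Rel U θ θ' := fun σ hσ h1 h2 => h σ (hσ.mono hV) h1 h2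

/-- Over a good set each point of the fibre lies on a section, so the relation prescribes every
value of `θ'`. -/
theorem Rel.eq {U : Set T} (hU : IsGood p U) {θ θ' : TrivCover cov} (h : Rel U θ θ')
    (hp : θ.pt = θ'.pt) (hθ : θ.pt ∈ U) : θ = θ' := by
  refine ext' hp fun e he he' => ?_
  obtain ⟨σ, hσ, hσe⟩ := hU.exists_section e (he ▸ hθ)
  have h1 : σ θ.pt = e := by rw [← he, hσe]
  have h2 : σ θ'.pt = e := by rw [← hp, h1]
  have := h σ hσ (by rw [h1, he]) (by rw [h2, he'])
  convert this using 3
  · exact Subtype.ext h1.symm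
  · exact Subtype.ext h2.symm

/-- Precompose with transport along any path inside `U`. The choice of path is irrelevant, since a
section over `U` is carried along itself. -/
theorem exists_rel {U : Set T} (hU : IsGood p U) (θ : TrivCover cov) (hθ : θ.pt ∈ U) {y : T}
    (hy : y ∈ U) : ∃ θ' : TrivCover cov, θ'.pt = y ∧ Rel U θ θ' := by
  obtain ⟨z, hz, γ, h⟩ := θ.exists_path
  have hJ := hU.isPathConnected.joinedIn y hy θ.pt hθ
  refine ⟨⟨y, fun e => θ.toFun (cov.monodromy (.mk hJ.somePath) e), z, hz,
    (Path.Homotopic.Quotient.mk hJ.somePath).trans γ, fun e => ?_⟩, rfl, ?_⟩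
  · rw [h, cov.monodromy_trans_apply]
  · intro σ hσ h1 h2
    dsimp only
    congr 1
    refine Subtype.ext ?_
    exact (hσ.monodromy_eq cov hJ.somePath hJ.somePath_mem _ rfl).symm

/-- A smaller set has more sections, so the relation over `W` is a priori stronger. But transport
inside `W` is also transport inside `U`, and the latter is unique. -/
theorem Rel.restrict {U W : Set T} (hU : IsGood p U) (hW : IsGood p W) (hWU : W ⊆ U)
    {θ θ' : TrivCover cov} (h : Rel U θ θ') (hθ : θ.pt ∈ W) (hθ' : θ'.pt ∈ W) : Rel W θ θ' := by
  obtain ⟨θ'', h1, h2⟩ := exists_rel hW θ hθ hθ'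
  rwa [Rel.eq hU (h.symm.trans (h2.mono hWU) (hWU hθ)) h1.symm (hWU hθ')]

/-- A basic open set of the total space. -/
def sheet (U : Set T) (θ : TrivCover cov) : Set (TrivCover cov) := {θ' | θ'.pt ∈ U ∧ Rel U θ θ'}

instance : TopologicalSpace (TrivCover cov) :=
  .generateFrom {S | ∃ (U : Set T) (θ : TrivCover cov), IsGood p U ∧ θ.pt ∈ U ∧ S = sheet U θ}

variable (hG : ∀ x : T, ∀ O ∈ 𝓝 x, ∃ U ⊆ O, x ∈ U ∧ IsGood p U)

theorem isOpen_sheet {U : Set T} {θ : TrivCover cov} (hU : IsGood p U) (hθ : θ.pt ∈ U) :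
    IsOpen (sheet U θ) := isOpen_generateFrom_of_mem ⟨U, θ, hU, hθ, rfl⟩

theorem mem_sheet_self {U : Set T} {θ : TrivCover cov} (hθ : θ.pt ∈ U) : θ ∈ sheet U θ :=
  ⟨hθ, Rel.refl _ _⟩

theorem sheet_subset {U V : Set T} {θ θ' : TrivCover cov} (h : V ⊆ U) (hθ : θ' ∈ sheet U θ) :
    sheet V θ' ⊆ sheet U θ :=
  fun _ h' => ⟨h h'.1, hθ.2.trans (h'.2.mono h) hθ.1⟩

include hG in
theorem exists_sheet_subset {S : Set (TrivCover cov)} {θ : TrivCover cov} (hS : S ∈ 𝓝 θ)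
    {O : Set T} (hO : O ∈ 𝓝 θ.pt) : ∃ U ⊆ O, θ.pt ∈ U ∧ IsGood p U ∧ sheet U θ ⊆ S := by
  have hb : IsTopologicalBasis
      {S | ∃ (U : Set T) (θ : TrivCover cov), IsGood p U ∧ θ.pt ∈ U ∧ S = sheet U θ} := by
    refine ⟨?_, ?_, rfl⟩
    · rintro _ ⟨U, θ₁, hU, h1, rfl⟩ _ ⟨V, θ₂, hV, h2, rfl⟩ θ ⟨hθ1, hθ2⟩
      obtain ⟨W, hW, hθW, hWg⟩ := hG θ.pt (U ∩ V)
        ((hU.isOpen.inter hV.isOpen).mem_nhds ⟨hθ1.1, hθ2.1⟩)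
      exact ⟨_, ⟨W, θ, hWg, hθW, rfl⟩, mem_sheet_self hθW,
        subset_inter (sheet_subset (hW.trans inter_subset_left) hθ1)
          (sheet_subset (hW.trans inter_subset_right) hθ2)⟩
    · refine eq_univ_of_forall fun θ => ?_
      obtain ⟨W, -, hθW, hWg⟩ := hG θ.pt univ univ_mem
      exact ⟨_, ⟨W, θ, hWg, hθW, rfl⟩, mem_sheet_self hθW⟩
  obtain ⟨_, ⟨U, θ₁, hU, h1, rfl⟩, hθ, hUS⟩ := hb.mem_nhds_iff.1 hS
  obtain ⟨W, hW, hθW, hWg⟩ := hG θ.pt (U ∩ O) (inter_mem (hU.isOpen.mem_nhds hθ.1) hO)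
  exact ⟨W, hW.trans inter_subset_right, hθW, hWg,
    (sheet_subset (hW.trans inter_subset_left) hθ).trans hUS⟩

include hG in
theorem continuous_pt : Continuous (pt (cov := cov)) := by
  rw [continuous_iff_continuousAt]
  intro θ O hO
  obtain ⟨W, hW, hθW, hWg⟩ := hG θ.pt O hO
  exact mem_map.2 (mem_of_superset ((isOpen_sheet hWg hθW).mem_nhds (mem_sheet_self hθW))
    fun θ' h' => hW h'.1)

/-- Parallel transport inside a good open set. -/
noncomputable def tr {U : Set T} (hU : IsGood p U) (θ : TrivCover cov) (hθ : θ.pt ∈ U) (y : U) :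
    TrivCover cov := (exists_rel hU θ hθ y.2).choose

section

variable {U : Set T} (hU : IsGood p U) (θ : TrivCover cov) (hθ : θ.pt ∈ U) (y : U)

@[simp] theorem tr_pt : (tr hU θ hθ y).pt = y := (exists_rel hU θ hθ y.2).choose_spec.1

theorem rel_tr : Rel U θ (tr hU θ hθ y) := (exists_rel hU θ hθ y.2).choose_spec.2

theorem tr_mem : (tr hU θ hθ y).pt ∈ U := by rw [tr_pt]; exact y.2

variable {θ y} in
theorem eq_tr {θ' : TrivCover cov} (h : θ'.pt = y) (h' : Rel U θ θ') : θ' = tr hU θ hθ y := by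
  have h1 : θ'.pt ∈ U := by rw [h]; exact y.2
  exact Rel.eq hU (h'.symm.trans (rel_tr hU θ hθ y) hθ) (by rw [h, tr_pt]) h1

end

include hG in
-- Over a good neighbourhood `U` of `x`, transport inside `U` to the fibre at `x` is the
-- trivialisation; the sheets are its level sets.
theorem isCoveringMap_pt : IsCoveringMap (pt (cov := cov)) := by
  intro x
  obtain ⟨U, -, hx, hU⟩ := hG x univ univ_mem
  let I := WithDiscreteTopology {θ : TrivCover cov // θ.pt = x}
  refine IsEvenlyCovered.to_isEvenlyCovered_preimage (I := I) ⟨inferInstance, U, hx, hU.isOpen,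
    hU.isOpen.preimage (continuous_pt hG), ?_⟩
  refine ⟨⟨⟨fun θ => (⟨θ.1.pt, θ.2⟩, .toTopology ⊥ ⟨tr hU θ.1 θ.2 ⟨x, hx⟩, tr_pt _ _ _ _⟩),
    fun yi => ⟨tr hU yi.2.ofTopology.1 (by rw [yi.2.ofTopology.2]; exact hx) yi.1, tr_mem _ _ _ _⟩,
    ?_, ?_⟩, ?_, ?_⟩, fun _ => rfl⟩
  · rintro ⟨θ, hθ⟩
    exact Subtype.ext (eq_tr hU (tr_mem _ _ _ _) rfl (rel_tr hU θ hθ _).symm).symm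
  · rintro ⟨y, ⟨⟨θ, rfl⟩⟩⟩
    refine Prod.ext (Subtype.ext (tr_pt _ _ _ _)) ?_
    refine congrArg (WithTopology.toTopology ⊥) (Subtype.ext ?_)
    exact (eq_tr hU (tr_mem _ _ _ _) rfl (rel_tr hU θ hx _).symm).symm
  · refine .prodMk (Continuous.subtype_mk ((continuous_pt hG).comp continuous_subtype_val) _) ?_
    rw [continuous_iff_continuousAt]
    rintro ⟨θ, hθ⟩
    simp only [ContinuousAt, nhds_discrete, tendsto_pure]
    have := (isOpen_sheet hU hθ).preimage
      (continuous_subtype_val (p := fun θ : TrivCover cov => θ ∈ pt ⁻¹' U))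
    filter_upwards [this.mem_nhds (mem_sheet_self hθ)] with θ' h'
    congr 2
    exact eq_tr hU _ (tr_pt _ _ _ _) (h'.2.trans (rel_tr hU _ _ _) h'.1) 
  · simp_rw [continuous_iff_continuousAt, continuousAt_prod_of_discrete_right]
    rintro ⟨y, ⟨⟨θ, rfl⟩⟩⟩
    rw [IsInducing.subtypeVal.continuousAt_iff]
    intro S hS
    obtain ⟨W, hWU, hy, hW, hWS⟩ := exists_sheet_subset hG hS
      (hU.isOpen.mem_nhds (tr_mem hU θ hx y))
    have hyW : (y : T) ∈ W := by rwa [← tr_pt hU θ hx y]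
    refine mem_map.2 ?_
    filter_upwards [(hW.isOpen.preimage continuous_subtype_val).mem_nhds hyW] with y' hy'
    have hy'' : (tr hU θ hx y').pt ∈ W := by rwa [tr_pt]
    exact hWS ⟨hy'', ((rel_tr hU θ hx y).symm.trans (rel_tr hU θ hx y') hx).restrict hU hW hWU
      hy hy''⟩

include hG in
/-- Pairs of compatible lifts to the trivialising cover and to the given cover are flat. -/
theorem isLocallyConstant_toFun {A : Type*} [TopologicalSpace A] {f : A → TrivCover cov}
    {g : A → E} (hf : Continuous f) (hg : Continuous g) (h : ∀ a, p (g a) = (f a).pt) :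
    IsLocallyConstant fun a => (f a).toFun ⟨g a, h a⟩ := by
  rw [IsLocallyConstant.iff_eventually_eq]
  intro a
  obtain ⟨U, -, ha, hU⟩ := hG (f a).pt univ univ_mem
  obtain ⟨σ, hσ, hσa⟩ := hU.exists_section (g a) (h a ▸ ha)
  have hpf : Continuous fun a => (f a).pt := (continuous_pt hG).comp hf
  -- Local injectivity of `p` forces the lift `g` to follow the section `σ` near `a`, where the
  -- sheet relation applies.
  obtain ⟨N, hN, haN, hinj⟩ := cov.isLocalHomeomorph.isLocallyInjective (g a)
  have hσc : ContinuousAt (fun a => σ (f a).pt) a :=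
    ContinuousAt.comp (f := fun a => (f a).pt) (hσ.1.continuousAt (hU.isOpen.mem_nhds ha))
      hpf.continuousAt
  have h1 : ∀ᶠ a' in 𝓝 a, σ (f a').pt ∈ N :=
    hσc.eventually (by simp only [← h, hσa]; exact hN.mem_nhds haN)
  filter_upwards [hf.continuousAt.eventually ((isOpen_sheet hU ha).mem_nhds (mem_sheet_self ha)),
    hg.continuousAt.eventually (hN.mem_nhds haN), h1] with a' h2 h3 h4
  have h5 : σ (f a').pt = g a' := hinj h4 h3 (by rw [hσ.2 _ h2.1, h])
  have h6 : σ (f a).pt = g a := by rw [← h, hσa]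
  have := h2.2 σ hσ (hσ.2 _ ha) (hσ.2 _ h2.1)
  simp only [h5, h6] at this
  exact this.symm

/-- The lifts of a path to both coverings form a compatible pair over the unit interval, so the
value is locally constant there, hence constant. -/
theorem toFun_monodromy {x y : T} (γ : Path.Homotopic.Quotient x y)
    (θ : pt (cov := cov) ⁻¹' {x}) (e : p ⁻¹' {x}) :
    ((isCoveringMap_pt hG).monodromy γ θ).1.toFun
      ⟨cov.monodromy γ e, (cov.monodromy γ e).2.trans ((isCoveringMap_pt hG).monodromy γ θ).2.symm⟩ =
      θ.1.toFun ⟨e, e.2.trans θ.2.symm⟩ := by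
  obtain ⟨γ⟩ := γ
  have h0 : γ 0 = pt θ.1 := γ.source.trans θ.2.symm
  have h1 : γ 0 = p e.1 := γ.source.trans e.2.symm
  have hl := (isCoveringMap_pt (cov := cov) hG).liftPath_lifts (γ := γ.toContinuousMap) (γ_0 := h0)
  have hl' := cov.liftPath_lifts (γ := γ.toContinuousMap) (γ_0 := h1)
  have hc := isLocallyConstant_toFun hG
    ((isCoveringMap_pt (cov := cov) hG).liftPath γ θ.1 h0).continuous
    (cov.liftPath γ e.1 h1).continuous
    (fun t => (congrFun hl' t).trans (congrFun hl t).symm)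
  have := hc.apply_eq_of_preconnectedSpace 1 0
  refine Eq.trans this ?_
  exact toFun_congr (IsCoveringMap.liftPath_zero ..) (IsCoveringMap.liftPath_zero ..)

theorem monodromy_eq_iff {x y : T} (γ : Path.Homotopic.Quotient x y)
    (θ : pt (cov := cov) ⁻¹' {x}) (θ' : pt (cov := cov) ⁻¹' {y}) :
    (isCoveringMap_pt hG).monodromy γ θ = θ' ↔ ∀ e : p ⁻¹' {x},
      θ'.1.toFun ⟨cov.monodromy γ e, (cov.monodromy γ e).2.trans θ'.2.symm⟩ =
      θ.1.toFun ⟨e, e.2.trans θ.2.symm⟩ := by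
  constructor
  · rintro rfl e
    exact toFun_monodromy hG γ θ e
  · intro h
    refine Subtype.ext (ext' (((isCoveringMap_pt hG).monodromy γ θ).2.trans θ'.2.symm) ?_)
    intro e he he'
    obtain ⟨e', h'⟩ := (cov.monodromy_bijective γ).2 ⟨e, he'.trans θ'.2⟩
    obtain rfl : (cov.monodromy γ e').1 = e := congrArg Subtype.val h'
    rw [toFun_monodromy hG, h]

variable (cov) in
/-- The point of the trivialising cover over a base point given by the constant path. -/
def base {z : T} (hz : IsBase z) : TrivCover cov :=
  ⟨z, Subtype.val, z, hz, .refl z, fun e => by rw [cov.monodromy_refl]; rfl⟩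

include hG in
-- The path that defines `θ` lifts to a path from `θ` to the identity over the base point. Hence
-- there is just one path component over each path component of the base.
theorem exists_joined_base (θ : TrivCover cov) :
    ∃ (z : T) (hz : IsBase z), Joined θ (base cov hz) ∧ Joined θ.pt z := by
  obtain ⟨z, hz, γ, h⟩ := θ.exists_path
  refine ⟨z, hz, ?_, ⟨γ.out⟩⟩
  have : ((isCoveringMap_pt hG).monodromy γ ⟨θ, rfl⟩) = ⟨base cov hz, rfl⟩ := by
    rw [monodromy_eq_iff hG]
    intro e
    exact (h e).symm
  have hq := (isCoveringMap_pt hG).liftPathQuotient γ ⟨θ, rfl⟩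
  rw [this] at hq
  exact ⟨hq.out⟩

theorem surjective_pt : Function.Surjective (pt (cov := cov)) := by
  intro x
  obtain ⟨z, hz, ⟨γ⟩⟩ := exists_isBase x
  exact ⟨⟨x, fun e => cov.monodromy (.mk γ) e, z, hz, .mk γ, fun _ => rfl⟩, rfl⟩

include hG in
theorem locallyPathConnectedSpace : LocallyPathConnectedSpace T := by
  refine .of_bases (p := fun x U => x ∈ U ∧ IsGood p U) (s := fun _ U => U) (fun x => ?_)
    fun x U h => h.2.isPathConnected
  refine ⟨fun O => ⟨fun hO => ?_, ?_⟩⟩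
  · obtain ⟨U, h1, h2, h3⟩ := hG x O hO
    exact ⟨U, ⟨h2, h3⟩, h1⟩
  · rintro ⟨U, ⟨h2, h3⟩, h1⟩
    exact mem_of_superset (h3.isOpen.mem_nhds h2) h1

theorem _root_.Joined.connectedComponents_eq {X : Type*} [TopologicalSpace X] {x y : X}
    (h : Joined x y) : (x : ConnectedComponents X) = y :=
  ConnectedComponents.coe_eq_coe.2 (connectedComponent_eq (pathComponent_subset_component x h))

theorem bijective_connectedComponentsMap :
    Function.Bijective (continuous_pt (cov := cov) hG).connectedComponentsMap := by
  have := locallyPathConnectedSpace hG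
  constructor
  · refine ConnectedComponents.surjective_coe.forall₂.2 fun θ θ' h => ?_
    have hj : Joined θ.pt θ'.pt :=
      (connectedComponent_eq_iff_joined _ _).1 (ConnectedComponents.coe_eq_coe.1 h)
    obtain ⟨z, hz, h1, h2⟩ := exists_joined_base hG θ
    obtain ⟨z', hz', h1', h2'⟩ := exists_joined_base hG θ'
    obtain rfl := hz.eq hz' ((h2.symm.trans hj).trans h2')
    exact (h1.trans h1'.symm).connectedComponents_eq
  · refine ConnectedComponents.surjective_coe.forall.2 fun x => ?_
    obtain ⟨θ, rfl⟩ := surjective_pt (cov := cov) x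
    exact ⟨θ, rfl⟩

/-- A loop comes from a loop at `θ` iff its lift closes up, iff transport along it fixes `θ`; as `θ`
is injective, this says that the loop acts trivially on the fibre. -/
theorem range_map (θ : TrivCover cov) :
    (FundamentalGroup.map ⟨pt (cov := cov), continuous_pt hG⟩ θ).range =
      (cov.monodromyPerm θ.pt).ker := by
  have cp := isCoveringMap_pt (cov := cov) hG
  ext γ
  rw [MonoidHom.mem_ker]
  have key : cov.monodromyPerm θ.pt γ = 1 ↔ cp.monodromy γ ⟨θ, rfl⟩ = ⟨θ, rfl⟩ := by
    rw [monodromy_eq_iff hG, Equiv.ext_iff]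
    refine forall_congr' fun e => ?_
    rw [IsCoveringMap.coe_monodromyPerm]
    exact θ.injective.eq_iff.symm
  rw [key]
  constructor
  · rintro ⟨δ, rfl⟩
    exact cp.monodromy_map δ
  · intro h
    refine ⟨(cp.liftPathQuotient γ ⟨θ, rfl⟩).cast rfl congr($h.symm), ?_⟩
    change Path.Homotopic.Quotient.map (Path.Homotopic.Quotient.cast _ _ _) _ = γ
    rw [Path.Homotopic.Quotient.map_cast, IsCoveringMap.map_liftPathQuotient]
    obtain ⟨γ⟩ := γ
    rfl

end TrivCover
end TrivializingCover
end FOne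

/-! ### Ideals, Rees quotients and induced topologies on monoids with zero -/

namespace FOne

theorem IsIdeal.mul_mem_right {A : Type*} [CommMonoidWithZero A] {I : Set A} (h : IsIdeal I)
    {a x : A} (hx : x ∈ I) : x * a ∈ I := mul_comm a x ▸ h.2 a x hx

theorem IsIdeal.preimage {A B : Type*} [CommMonoidWithZero A] [CommMonoidWithZero B] {I : Set B}
    (h : IsIdeal I) (φ : A →*₀ B) : IsIdeal (φ ⁻¹' I) :=
  ⟨by simpa using h.1, fun a x hx => by simpa using h.2 (φ a) _ hx⟩

section Rees

variable {M : Type*} [CommMonoidWithZero M]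

/-- The congruence collapsing an ideal. -/
def reesCon (J : Set M) (hJ : IsIdeal J) : Con M where
  r x y := x = y ∨ x ∈ J ∧ y ∈ J
  iseqv := ⟨fun _ => .inl rfl, fun h => h.imp Eq.symm And.symm, by
    rintro x y z (rfl | h) (rfl | h')
    exacts [.inl rfl, .inr h', .inr h, .inr ⟨h.1, h'.2⟩]⟩
  mul' := by
    rintro w x y z (rfl | h) (rfl | h')
    exacts [.inl rfl, .inr ⟨hJ.2 _ _ h'.1, hJ.2 _ _ h'.2⟩,
      .inr ⟨hJ.mul_mem_right h.1, hJ.mul_mem_right h.2⟩, .inr ⟨hJ.2 _ _ h'.1, hJ.2 _ _ h'.2⟩]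

variable (J : Set M) (hJ : IsIdeal J)

instance : CommMonoidWithZero (reesCon J hJ).Quotient where
  zero := ((0 : M) : (reesCon J hJ).Quotient)
  zero_mul a := by
    induction a using Con.induction_on with | _ a
    exact congrArg _ (zero_mul a)
  mul_zero a := by
    induction a using Con.induction_on with | _ a
    exact congrArg _ (mul_zero a)

/-- The projection to the quotient by an ideal. -/
def reesMk : M →*₀ (reesCon J hJ).Quotient where
  toFun x := x
  map_zero' := rfl
  map_one' := rfl
  map_mul' _ _ := rfl

variable {J hJ}

theorem reesMk_eq {x y : M} : reesMk J hJ x = reesMk J hJ y ↔ x = y ∨ x ∈ J ∧ y ∈ J :=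
  (reesCon J hJ).eq

theorem reesMk_eq_zero {x : M} : reesMk J hJ x = 0 ↔ x ∈ J := by
  rw [← map_zero (reesMk J hJ), reesMk_eq]
  exact ⟨fun h => h.elim (fun h => h ▸ hJ.1) And.left, fun h => .inr ⟨h, hJ.1⟩⟩

theorem reesMk_surjective : Function.Surjective (reesMk J hJ) := Quotient.mk_surjective

/-- Homomorphisms out of the quotient by an ideal. -/
def reesLift {N : Type*} [CommMonoidWithZero N] (φ : M →*₀ N) (h : ∀ x ∈ J, φ x = 0) :
    (reesCon J hJ).Quotient →*₀ N where
  toFun x := Con.liftOn x φ fun a b hab => by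
    obtain rfl | hab := hab
    exacts [rfl, (h _ hab.1).trans (h _ hab.2).symm]
  map_zero' := map_zero φ
  map_one' := map_one φ
  map_mul' x y := by
    induction x using Con.induction_on
    induction y using Con.induction_on
    exact map_mul φ _ _

end Rees

@[simp] theorem ev_comp {A B C : AdmAlg.{u}} (φ : A ⟶ B) (ψ : B ⟶ C) (a : A) :
    AdmAlg.ev (φ ≫ ψ) a = AdmAlg.ev ψ (AdmAlg.ev φ a) := rfl

theorem hom_ext {A B : AdmAlg.{u}} {φ ψ : A ⟶ B} (h : ∀ a, AdmAlg.ev φ a = AdmAlg.ev ψ a) :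
    φ = ψ := AdmAlg.Hom.ext (DFunLike.ext _ _ h)

theorem ev_mem {A B : AdmAlg.{u}} (φ : A ⟶ B) {I : Set B} (hI : I ∈ B.openIdeals) :
    AdmAlg.ev φ ⁻¹' I ∈ A.openIdeals := φ.continuous I hI

/-- Generators of an ideal of definition. -/
noncomputable def AdmAlg.gens (A : AdmAlg.{u}) : Finset A := A.exists_ideal_of_definition.choose

theorem AdmAlg.mem_openIdeals {A : AdmAlg.{u}} {I : Set A} : I ∈ A.openIdeals ↔
    IsIdeal I ∧ ∃ n : ℕ, ∀ s : Fin n → A, (∀ i, s i ∈ A.gens) → ∏ i, s i ∈ I :=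
  A.exists_ideal_of_definition.choose_spec I

theorem AdmAlg.isIdeal {A : AdmAlg.{u}} {I : Set A} (h : I ∈ A.openIdeals) : IsIdeal I :=
  (AdmAlg.mem_openIdeals.1 h).1

theorem AdmAlg.exists_open_one_notMem (A : AdmAlg.{u}) : ∃ I ∈ A.openIdeals, (1 : A) ∉ I := by
  by_contra! h
  exact one_ne_zero (A.hausdorff 1 h)

theorem AdmAlg.exists_pow_mem {A : AdmAlg.{u}} {I : Set A} (h : I ∈ A.openIdeals) {s : A}
    (hs : s ∈ A.gens) : ∃ n : ℕ, s ^ n ∈ I := by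
  obtain ⟨n, hn⟩ := (AdmAlg.mem_openIdeals.1 h).2
  exact ⟨n, by simpa using hn (fun _ => s) fun _ => hs⟩

/-- An ideal is open as soon as the complement is closed under products and it contains the
generators. -/
theorem AdmAlg.mem_openIdeals_of_gens {A : AdmAlg.{u}} {I : Set A} (hI : IsIdeal I)
    (h : ∀ s ∈ A.gens, s ∈ I) : I ∈ A.openIdeals :=
  AdmAlg.mem_openIdeals.2 ⟨hI, 1, fun s hs => by simpa using h _ (hs 0)⟩

/-- The algebra `R` over `A` with the induced topology. -/
def AdmAlg.push (A : AdmAlg.{u}) (R : Type u) [CommMonoidWithZero R] [Nontrivial R]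
    (ι : A →*₀ R)
    (h : ∀ x, (∀ I, IsIdeal I → ι ⁻¹' I ∈ A.openIdeals → x ∈ I) → x = 0) : AdmAlg.{u} where
  carrier := R
  openIdeals := {I | IsIdeal I ∧ ι ⁻¹' I ∈ A.openIdeals}
  exists_ideal_of_definition := by
    classical
    refine ⟨A.gens.image ι, fun I => ?_⟩
    refine and_congr_right fun hI => ?_
    rw [AdmAlg.mem_openIdeals, and_iff_right (hI.preimage ι)]
    refine exists_congr fun n => ⟨fun H t ht => ?_, fun H s hs => ?_⟩
    · choose s hs hst using fun i => Finset.mem_image.1 (ht i)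
      obtain rfl : (fun i => ι (s i)) = t := funext hst
      rw [← map_prod]
      exact H s hs
    · rw [Set.mem_preimage, map_prod]
      exact H _ fun i => Finset.mem_image_of_mem _ (hs i)
  hausdorff a ha := h a fun I hI hI' => ha I ⟨hI, hI'⟩

/-! ### Points and topology of the formal spectrum -/

section Points

theorem pt_cases (x : pt.{u}) : x = 0 ∨ x = 1 := by
  change WithZero PUnit.{u + 1} at x
  induction x using WithZero.cases_on
  exacts [.inl rfl, fun _ => .inr rfl]

theorem isUnit_pt {x : pt.{u}} (h : x ≠ 0) : IsUnit x := by
  rw [(pt_cases x).resolve_left h]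
  exact isUnit_one

theorem pt_openIdeals {I : Set pt.{u}} (h : I ∈ pt.openIdeals) : I = {0} ∨ I = Set.univ := by
  have hI := AdmAlg.isIdeal h
  by_cases h1 : (1 : pt.{u}) ∈ I
  · right
    ext x
    simpa using hI.2 x 1 h1
  · left
    ext x
    obtain rfl | rfl := pt_cases x
    · simpa using hI.1
    · simpa using h1

/-- The point of the formal spectrum given by a homomorphism whose kernel is open. -/
def mkPrime {A : AdmAlg.{u}} (φ : A →*₀ pt.{u}) (h : ∀ s ∈ A.gens, φ s = 0) : Prime A :=
  ⟨φ, fun I hI => by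
    obtain rfl | rfl := pt_openIdeals hI
    · exact AdmAlg.mem_openIdeals_of_gens ((AdmAlg.isIdeal hI).preimage φ) h
    · exact AdmAlg.mem_openIdeals_of_gens ((AdmAlg.isIdeal hI).preimage φ) fun _ _ => trivial⟩

@[simp] theorem ev_mkPrime {A : AdmAlg.{u}} (φ : A →*₀ pt.{u}) (h : ∀ s ∈ A.gens, φ s = 0) (a : A) :
    AdmAlg.ev (mkPrime φ h) a = φ a := rfl

theorem zero_mem_openIdeals_pt : ({0} : Set pt.{u}) ∈ pt.openIdeals :=
  ⟨rfl, by rintro b x (rfl : x = 0); exact mul_zero b⟩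

/-- Generators are topologically nilpotent, and `𝔽₁` has no nonzero nilpotents. -/
theorem ev_gens {A : AdmAlg.{u}} (𝔭 : Prime A) {s : A} (hs : s ∈ A.gens) : AdmAlg.ev 𝔭 s = 0 := by
  obtain ⟨n, hn⟩ := AdmAlg.exists_pow_mem (ev_mem 𝔭 zero_mem_openIdeals_pt) hs
  have : AdmAlg.ev 𝔭 s ^ n = 0 := by simpa using hn
  by_contra h
  exact ((isUnit_pt h).pow n).ne_zero this

open Classical in
/-- The homomorphism to `𝔽₁` that is nonzero exactly on a prime filter. -/
noncomputable def indicator {A : Type*} [CommMonoidWithZero A] (F : A → Prop) (h0 : ¬F 0) (h1 : F 1)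
    (hm : ∀ a b, F (a * b) ↔ F a ∧ F b) : A →*₀ pt.{u} where
  toFun a := if F a then 1 else 0
  map_zero' := by simp [h0]
  map_one' := by simp [h1]
  map_mul' a b := by
    simp only [hm]
    split_ifs <;> simp_all

theorem indicator_ne_zero {A : Type*} [CommMonoidWithZero A] {F : A → Prop} {h0 : ¬F 0} {h1 : F 1}
    {hm : ∀ a b, F (a * b) ↔ F a ∧ F b} {a : A} : indicator.{u} F h0 h1 hm a ≠ 0 ↔ F a := by
  classical
  change (if F a then (1 : pt.{u}) else 0) ≠ 0 ↔ _
  split_ifs with h <;> simp [h]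

/-- The closed point: its ideal consists of all nonunits. -/
noncomputable def closedPt (A : AdmAlg.{u}) : Prime A :=
  mkPrime (indicator IsUnit (by simp) (by simp) fun a b => by simp)
    fun s hs => by
      by_contra h
      have h : IsUnit s := indicator_ne_zero.1 h
      obtain ⟨I, hI, h1⟩ := A.exists_open_one_notMem
      obtain ⟨n, hn⟩ := AdmAlg.exists_pow_mem hI hs
      obtain ⟨b, hb⟩ := (h.pow n).exists_left_inv
      exact h1 (hb ▸ (AdmAlg.isIdeal hI).2 b _ hn)

theorem ev_closedPt_ne_zero {A : AdmAlg.{u}} {a : A} : AdmAlg.ev (closedPt A) a ≠ 0 ↔ IsUnit a := by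
  unfold closedPt
  rw [ev_mkPrime]
  exact indicator_ne_zero

theorem isUnit_iff_forall_prime {A : AdmAlg.{u}} {a : A} :
    IsUnit a ↔ ∀ 𝔭 : Prime A, AdmAlg.ev 𝔭 a ≠ 0 :=
  ⟨fun h 𝔭 => (h.map (AdmAlg.ev 𝔭)).ne_zero, fun h => ev_closedPt_ne_zero.1 (h _)⟩

/-- An element lying in all open primes is topologically nilpotent. -/
theorem exists_pow_mem_of_forall_prime {A : AdmAlg.{u}} {a : A}
    (h : ∀ 𝔭 : Prime A, AdmAlg.ev 𝔭 a = 0) {I : Set A} (hI : I ∈ A.openIdeals) :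
    ∃ n : ℕ, a ^ n ∈ I := by
  by_contra! H
  have hF : ∀ x c n, x * c = a ^ n → x ∉ I := fun x c n hx hxI =>
    H n (hx ▸ (AdmAlg.isIdeal hI).mul_mem_right hxI)
  -- The divisors of powers of `a` form a prime filter. A generator in it would have a power in `I`
  -- dividing a power of `a`, so the complementary prime is open.
  let 𝔭 : Prime A := mkPrime (indicator (fun x => ∃ n : ℕ, x ∣ a ^ n)
    (by rintro ⟨n, c, hc⟩; exact hF _ _ _ hc.symm (AdmAlg.isIdeal hI).1)
    ⟨0, one_dvd _⟩ fun x y => ⟨fun ⟨n, hn⟩ => ⟨⟨n, dvd_of_mul_right_dvd hn⟩,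
      ⟨n, dvd_of_mul_left_dvd hn⟩⟩, fun ⟨⟨n, hn⟩, ⟨m, hm⟩⟩ =>
        ⟨n + m, pow_add a n m ▸ mul_dvd_mul hn hm⟩⟩) fun s hs => by
      by_contra h
      obtain ⟨n, hn⟩ := indicator_ne_zero.1 h
      obtain ⟨m, hm⟩ := AdmAlg.exists_pow_mem hI hs
      obtain ⟨c, hc⟩ := pow_dvd_pow_of_dvd hn m
      exact hF (s ^ m) c (n * m) (by rw [← hc, pow_mul]) hm
  refine absurd (h 𝔭) ?_
  rw [ev_mkPrime]
  exact indicator_ne_zero.2 ⟨1, by simp⟩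

attribute [instance] zariski

/-- The basic open subset `D(f)` of the formal spectrum. -/
def basicOpen {A : AdmAlg.{u}} (f : A) : Set (Prime A) := {𝔭 | AdmAlg.ev 𝔭 f ≠ 0}

theorem mem_basicOpen {A : AdmAlg.{u}} {f : A} {𝔭 : Prime A} :
    𝔭 ∈ basicOpen f ↔ AdmAlg.ev 𝔭 f ≠ 0 := Iff.rfl

theorem isOpen_basicOpen {A : AdmAlg.{u}} (f : A) : IsOpen (basicOpen f) :=
  isOpen_generateFrom_of_mem ⟨f, rfl⟩

theorem basicOpen_mul {A : AdmAlg.{u}} (f g : A) :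
    basicOpen (f * g) = basicOpen f ∩ basicOpen g := by
  ext 𝔭
  simp only [mem_basicOpen, Set.mem_inter_iff, map_mul]
  refine ⟨fun h => ⟨left_ne_zero_of_mul h, right_ne_zero_of_mul h⟩, fun h => ?_⟩
  exact ((isUnit_pt h.1).mul (isUnit_pt h.2)).ne_zero

theorem isTopologicalBasis_basicOpen (A : AdmAlg.{u}) :
    IsTopologicalBasis {D | ∃ f : A, D = basicOpen f} := by
  refine ⟨?_, ?_, rfl⟩
  · rintro _ ⟨f, rfl⟩ _ ⟨g, rfl⟩ 𝔭 h
    exact ⟨_, ⟨f * g, rfl⟩, by rwa [basicOpen_mul], (basicOpen_mul f g).le⟩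
  · refine Set.eq_univ_of_forall fun 𝔭 => ⟨_, ⟨1, rfl⟩, ?_⟩
    simp [mem_basicOpen]

theorem exists_basicOpen_subset {A : AdmAlg.{u}} {O : Set (Prime A)} (hO : IsOpen O) {𝔭 : Prime A}
    (h : 𝔭 ∈ O) : ∃ f : A, 𝔭 ∈ basicOpen f ∧ basicOpen f ⊆ O := by
  obtain ⟨_, ⟨f, rfl⟩, h⟩ := (isTopologicalBasis_basicOpen A).isOpen_iff.1 hO 𝔭 h
  exact ⟨f, h⟩

/-- A basic open `D(f)` contains the closed point only if `f` is a unit. This is the locality on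
which all statements about affine opens rest. -/
theorem eq_univ_of_closedPt_mem {A : AdmAlg.{u}} {O : Set (Prime A)} (hO : IsOpen O)
    (h : closedPt A ∈ O) : O = Set.univ := by
  obtain ⟨f, hf, hfO⟩ := exists_basicOpen_subset hO h
  refine Set.eq_univ_of_forall fun 𝔭 => hfO ?_
  exact isUnit_iff_forall_prime.1 (ev_closedPt_ne_zero.1 hf) 𝔭

theorem continuous_comp {A B : AdmAlg.{u}} (φ : A ⟶ B) :
    Continuous fun 𝔭 : Prime B => (φ ≫ 𝔭 : Prime A) := by
  refine continuous_generateFrom_iff.2 ?_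
  rintro _ ⟨f, rfl⟩
  exact isOpen_basicOpen (AdmAlg.ev φ f)

instance : Unique (Prime pt.{u}) where
  default := 𝟙 pt
  uniq 𝔭 := by
    refine hom_ext fun a => ?_
    obtain rfl | rfl := pt_cases a <;> simp

end Points

/-! ### Completed localisation at one element -/

section Loc

/-- `φ : A ⟶ B` exhibits `B` as the completed localisation of `A` at `f`. -/
structure IsLoc {A B : AdmAlg.{u}} (f : A) (φ : A ⟶ B) : Prop where
  isUnit : IsUnit (AdmAlg.ev φ f)
  surj : ∀ b : B, ∃ (n : ℕ) (a : A), b * AdmAlg.ev φ f ^ n = AdmAlg.ev φ a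
  eq_or : ∀ a a' : A, AdmAlg.ev φ a = AdmAlg.ev φ a' →
    (∃ n : ℕ, a * f ^ n = a' * f ^ n) ∨ AdmAlg.ev φ a = 0
  mem_openIdeals : ∀ I, I ∈ B.openIdeals ↔ IsIdeal I ∧ AdmAlg.ev φ ⁻¹' I ∈ A.openIdeals
  lift : ∀ (C : AdmAlg.{u}) (ψ : A ⟶ C), IsUnit (AdmAlg.ev ψ f) → ∃ χ : B ⟶ C, φ ≫ χ = ψ

/-- Invert `f`, then collapse `J`, the intersection of all ideals with open preimage in `A`, to make
the induced topology Hausdorff. A Rees quotient identifies only elements of `J`, which is why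
`eq_or` has just two cases. -/
theorem exists_isLoc {A : AdmAlg.{u}} {f : A} {𝔭 : Prime A} (hf : 𝔭 ∈ basicOpen f) :
    ∃ (B : AdmAlg.{u}) (φ : A ⟶ B), IsLoc f φ := by
  let S := Submonoid.powers f
  let L := Localization S
  let loc : Submonoid.LocalizationMap S L := Localization.monoidOf S
  let ι₀ : A →*₀ L := { loc.toMonoidHom with map_zero' := loc.map_zero }
  have hι₀ : ∀ a, ι₀ a = loc a := fun _ => rfl
  let J : Set L := {x | ∀ I, IsIdeal I → ι₀ ⁻¹' I ∈ A.openIdeals → x ∈ I}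
  have hJ : IsIdeal J := ⟨fun I hI _ => hI.1, fun a x hx I hI hI' => hI.2 a x (hx I hI hI')⟩
  have hlift : ∀ {C : AdmAlg.{u}} (ψ : A ⟶ C), IsUnit (AdmAlg.ev ψ f) → ∃ χ : L →*₀ C,
      (∀ a, χ (ι₀ a) = AdmAlg.ev ψ a) ∧ ∀ x ∈ J, χ x = 0 := by
    intro C ψ hψ
    have hS : ∀ y : S, IsUnit (AdmAlg.ev ψ y) := by
      rintro ⟨_, n, rfl⟩
      simpa using hψ.pow n
    have hχ : ∀ a, loc.lift₀ (AdmAlg.ev ψ) hS (ι₀ a) = AdmAlg.ev ψ a := fun a =>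
      loc.lift_eq _ a
    refine ⟨loc.lift₀ (AdmAlg.ev ψ) hS, hχ, fun x hx => C.hausdorff _ fun I hI => ?_⟩
    refine hx _ ((AdmAlg.isIdeal hI).preimage _) ?_
    rw [← Set.preimage_comp, show (loc.lift₀ (AdmAlg.ev ψ) hS) ∘ ι₀ = AdmAlg.ev ψ from funext hχ]
    exact ev_mem ψ hI
  let R := (reesCon J hJ).Quotient
  let ι : A →*₀ R := (reesMk J hJ).comp ι₀
  have hnt : Nontrivial R := by
    refine ⟨⟨1, 0, fun h => ?_⟩⟩
    -- The prime `𝔭` does not contain `f`, so it extends to the localisation and kills `J`; hence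
    -- `1` is not in `J`.
    obtain ⟨χ, -, hχ⟩ := hlift 𝔭 (isUnit_pt hf)
    have h1 : (1 : L) ∈ J := reesMk_eq_zero.1 ((map_one (reesMk J hJ)).trans h)
    have := hχ 1 h1
    rw [map_one] at this
    exact one_ne_zero this
  let B := A.push R ι fun x hx => by
    obtain ⟨x, rfl⟩ := reesMk_surjective x
    rw [reesMk_eq_zero]
    intro I hI hI'
    -- Since `I` contains `J`, it is the full preimage of its image, so the image is an open ideal
    -- of the quotient.
    have hJI : J ⊆ I := fun y hy => hy I hI hI'
    have hpre : ∀ y, reesMk J hJ y ∈ reesMk J hJ '' I ↔ y ∈ I := by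
      refine fun y => ⟨?_, fun h => ⟨y, h, rfl⟩⟩
      rintro ⟨z, hz, hzy⟩
      obtain rfl | h := reesMk_eq.1 hzy
      exacts [hz, hJI h.2]
    refine (hpre x).1 (hx _ ⟨⟨0, hI.1, rfl⟩, ?_⟩ ?_)
    · rintro a _ ⟨z, hz, rfl⟩
      obtain ⟨a, rfl⟩ := reesMk_surjective a
      exact ⟨a * z, hI.2 _ _ hz, map_mul _ _ _⟩
    · convert hI' using 1
      ext a
      exact hpre (ι₀ a)
  let φ : A ⟶ B := ⟨ι, fun I hI => hI.2⟩
  refine ⟨B, φ, ⟨?_, ?_, ?_, fun I => Iff.rfl, ?_⟩⟩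
  · exact (loc.map_units ⟨f, 1, pow_one f⟩).map (reesMk J hJ)
  · intro b
    obtain ⟨x, rfl⟩ := reesMk_surjective (J := J) (hJ := hJ) b
    obtain ⟨⟨a, ⟨_, n, rfl⟩⟩, ha⟩ := loc.surj x
    refine ⟨n, a, ?_⟩
    change reesMk J hJ x * reesMk J hJ (ι₀ f) ^ n = reesMk J hJ (ι₀ a)
    rw [← map_pow, ← map_mul, ← map_pow]
    exact congrArg _ ha
  · intro a a' h
    obtain h | h := reesMk_eq.1 h
    · left
      obtain ⟨⟨_, n, rfl⟩, hn⟩ := loc.eq_iff_exists.1 h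
      exact ⟨n, by simpa [mul_comm] using hn⟩
    · exact .inr (reesMk_eq_zero.2 h.1)
  · intro C ψ hψ
    obtain ⟨χ, hχ, hχJ⟩ := hlift ψ hψ
    refine ⟨⟨reesLift χ hχJ, fun I hI => ⟨(AdmAlg.isIdeal hI).preimage _, ?_⟩⟩, hom_ext hχ⟩
    convert ev_mem ψ hI using 1
    ext a
    exact Eq.to_iff (congrArg (· ∈ I) (hχ a))

namespace IsLoc

variable {A B : AdmAlg.{u}} {f : A} {φ : A ⟶ B} (h : IsLoc f φ)
include h

theorem monoidHom_ext {C : Type*} [CommMonoidWithZero C] {χ χ' : B →*₀ C}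
    (hχ : ∀ a, χ (AdmAlg.ev φ a) = χ' (AdmAlg.ev φ a)) : χ = χ' := by
  ext b
  obtain ⟨n, a, hb⟩ := h.surj b
  have h1 := congrArg χ hb
  have h2 := congrArg χ' hb
  rw [hχ, ← h2, map_mul, map_mul, map_pow, map_pow, hχ] at h1
  exact ((h.isUnit.map χ').pow n).mul_right_cancel h1

theorem ext {C : AdmAlg.{u}} {χ χ' : B ⟶ C} (hχ : φ ≫ χ = φ ≫ χ') : χ = χ' := by
  have := h.monoidHom_ext (χ := AdmAlg.ev χ) (χ' := AdmAlg.ev χ')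
    fun a => congrArg (fun ψ => AdmAlg.ev ψ a) hχ
  exact hom_ext fun a => DFunLike.congr_fun this a

theorem isOpenEmbedding :
    Topology.IsOpenEmbedding fun 𝔭 : Prime B => (φ ≫ 𝔭 : Prime A) := by
  refine ⟨⟨⟨le_antisymm (continuous_comp φ).le_induced (le_generateFrom ?_)⟩,
    fun 𝔭 𝔮 h' => h.ext h'⟩, ?_⟩
  · rintro _ ⟨b, rfl⟩
    obtain ⟨n, a, hb⟩ := h.surj b
    refine isOpen_induced_iff.2 ⟨basicOpen a, isOpen_basicOpen a, ?_⟩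
    ext 𝔭
    change AdmAlg.ev 𝔭 (AdmAlg.ev φ a) ≠ 0 ↔ AdmAlg.ev 𝔭 b ≠ 0
    rw [← hb, map_mul]
    have hu := (h.isUnit.pow n).map (AdmAlg.ev 𝔭)
    refine not_congr ⟨fun h0 => ?_, fun h0 => by rw [h0, zero_mul]⟩
    exact hu.mul_right_cancel (h0.trans (zero_mul _).symm)
  · have : Set.range (fun 𝔭 : Prime B => (φ ≫ 𝔭 : Prime A)) = basicOpen f := by
      ext 𝔭
      constructor
      · rintro ⟨𝔮, rfl⟩
        exact (h.isUnit.map (AdmAlg.ev 𝔮)).ne_zero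
      · intro hf
        exact h.lift _ 𝔭 (isUnit_pt hf)
    rw [this]
    exact isOpen_basicOpen f

theorem exists_prime {𝔭 : Prime A} (hf : 𝔭 ∈ basicOpen f) : ∃ 𝔮 : Prime B, φ ≫ 𝔮 = 𝔭 :=
  h.lift _ 𝔭 (isUnit_pt hf)

theorem mem_basicOpen (𝔮 : Prime B) : (φ ≫ 𝔮 : Prime A) ∈ basicOpen f :=
  (h.isUnit.map (AdmAlg.ev 𝔮)).ne_zero

/-- A homomorphism out of a localisation is continuous if its restriction is. -/
theorem continuous_of_comp {C : AdmAlg.{u}} (χ : B →*₀ C)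
    (hχ : ∀ I ∈ C.openIdeals, (χ.comp (AdmAlg.ev φ)) ⁻¹' I ∈ A.openIdeals) :
    ∀ I ∈ C.openIdeals, χ ⁻¹' I ∈ B.openIdeals := fun I hI =>
  (h.mem_openIdeals _).2 ⟨(AdmAlg.isIdeal hI).preimage χ, hχ I hI⟩

/-- Transport along an isomorphism. -/
theorem of_iso {B' : AdmAlg.{u}} {φ' : A ⟶ B'} (χ : B ⟶ B') (χ' : B' ⟶ B) (h1 : φ ≫ χ = φ')
    (h2 : χ ≫ χ' = 𝟙 _) (h3 : χ' ≫ χ = 𝟙 _) : IsLoc f φ' := by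
  have e1 : ∀ b, AdmAlg.ev χ' (AdmAlg.ev χ b) = b :=
    fun b => congrArg (fun ψ => AdmAlg.ev ψ b) h2
  have e2 : ∀ b, AdmAlg.ev χ (AdmAlg.ev χ' b) = b :=
    fun b => congrArg (fun ψ => AdmAlg.ev ψ b) h3
  subst h1
  refine ⟨h.isUnit.map (AdmAlg.ev χ), fun b => ?_, fun a a' haa => ?_, fun I => ⟨fun hI =>
    ⟨AdmAlg.isIdeal hI, ev_mem _ hI⟩, fun hI => ?_⟩, fun C ψ hψ => ?_⟩
  · obtain ⟨n, a, hb⟩ := h.surj (AdmAlg.ev χ' b)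
    refine ⟨n, a, ?_⟩
    rw [ev_comp, ev_comp, ← hb, map_mul, e2, map_pow]
  · have := congrArg (AdmAlg.ev χ') haa
    rw [ev_comp, ev_comp, e1, e1] at this
    refine (h.eq_or a a' this).imp_right fun h0 => ?_
    rw [ev_comp, h0, map_zero]
  · have := ev_mem χ' ((h.mem_openIdeals (AdmAlg.ev χ ⁻¹' I)).2 ⟨hI.1.preimage _, hI.2⟩)
    rw [← Set.preimage_comp] at this
    convert this using 1
    ext b
    simp [e2]
  · obtain ⟨θ, rfl⟩ := h.lift C ψ hψ
    refine ⟨χ' ≫ θ, ?_⟩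
    rw [Category.assoc, reassoc_of% h2]

end IsLoc

end Loc

end FOne

/-! ### Affine charts of a formal scheme -/

namespace FOne

open Set Topology

section Points

variable {X : FPsh.{u}}

@[simp] theorem imagePt_map {A B : AdmAlg.{u}} (φ : A ⟶ B) (x : X.obj A) (𝔭 : Prime B) :
    imagePt (X.map φ x) 𝔭 = imagePt x (φ ≫ 𝔭) :=
  (X.map_comp_apply φ 𝔭 x).symm

@[simp] theorem imagePt_id (x : Pt X) : imagePt (X := X) (A := pt) x (𝟙 pt) = x :=
  X.map_id_apply pt x

theorem imagePt_pt (x : Pt X) (𝔭 : Prime pt) : imagePt (X := X) (A := pt) x 𝔭 = x := by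
  rw [Subsingleton.elim 𝔭 (𝟙 pt), imagePt_id]

theorem isOpen_iff {S : Set (Pt X)} :
    IsOpen S ↔ ∀ (A : AdmAlg.{u}) (x : X.obj A), IsOpen (imagePt x ⁻¹' S) := by
  rw [isOpen_iSup_iff]
  refine forall_congr' fun A => ?_
  rw [isOpen_iSup_iff]
  exact forall_congr' fun x => isOpen_coinduced

theorem continuous_imagePt {A : AdmAlg.{u}} (x : X.obj A) : Continuous (imagePt x) :=
  ⟨fun _ hS => isOpen_iff.1 hS A x⟩

theorem mem_supported_of_closedPt {V : Opens (Pt X)} {A : AdmAlg.{u}} {x : X.obj A}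
    (h : imagePt x (closedPt A) ∈ V) : x ∈ (supported X V).obj A := by
  have := eq_univ_of_closedPt_mem (V.isOpen.preimage (continuous_imagePt x)) h
  exact fun 𝔭 => this.ge (mem_univ 𝔭)

/-- The path that is the closed point at time `0` and `𝔮` afterwards is continuous, because an open
set containing the closed point is everything. -/
instance (A : AdmAlg.{u}) : PathConnectedSpace (Prime A) := by
  have key : ∀ 𝔮 : Prime A, Joined (closedPt A) 𝔮 := by
    intro 𝔮
    classical
    refine ⟨⟨⟨fun t => if t = 0 then closedPt A else 𝔮, ⟨fun O hO => ?_⟩⟩, by simp, by simp⟩⟩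
    by_cases h : closedPt A ∈ O
    · rw [eq_univ_of_closedPt_mem hO h, preimage_univ]
      exact isOpen_univ
    · by_cases h' : 𝔮 ∈ O
      · convert isOpen_compl_singleton (X := unitInterval) (x := 0) using 1
        ext t
        by_cases ht : t = 0 <;> simp [ht, h, h']
      · convert isOpen_empty (X := unitInterval) using 1
        ext t
        by_cases ht : t = 0 <;> simp [ht, h, h']
  exact ⟨⟨closedPt A⟩, fun 𝔭 𝔮 => (key 𝔭).symm.trans (key 𝔮)⟩

end Points

namespace IsAffineChart

variable {X : FPsh.{u}} {A : AdmAlg.{u}} {a : X.obj A} {V : Opens (Pt X)}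
  (h : IsAffineChart a V)
include h

theorem hom_ext {B : AdmAlg.{u}} {φ ψ : A ⟶ B} (e : X.map φ a = X.map ψ a) : φ = ψ := h.1 B e

theorem mem_supported_self : a ∈ (supported X V).obj A := (h.2 A a).1 ⟨𝟙 _, by simp⟩

theorem imagePt_mem (𝔭 : Prime A) : imagePt a 𝔭 ∈ V := h.mem_supported_self 𝔭

theorem exists_hom {B : AdmAlg.{u}} {y : X.obj B} (hy : y ∈ (supported X V).obj B) :
    ∃ φ : A ⟶ B, X.map φ a = y := (h.2 B y).2 hy

theorem exists_prime {x : Pt X} (hx : x ∈ V) : ∃ 𝔭 : Prime A, imagePt a 𝔭 = x :=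
  h.exists_hom (B := pt) fun 𝔭 => by rwa [imagePt_pt]

theorem injective_imagePt : Function.Injective (imagePt a) := fun _ _ e => h.hom_ext e

theorem range_imagePt : range (imagePt a) = V := by
  ext x
  exact ⟨fun ⟨𝔭, e⟩ => e ▸ h.imagePt_mem 𝔭, fun hx => h.exists_prime hx⟩

/-- The topology of `X` is tested on all spectra `Spec B` over `X`. Near a point of `Spec B` that
lies over `V`, a localisation of `B` factors through the chart, and its spectrum is open in `Spec
B`. -/
theorem isOpenEmbedding : IsOpenEmbedding (imagePt a) := by
  refine .of_continuous_injective_isOpenMap (continuous_imagePt a) h.injective_imagePt ?_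
  intro D hD
  rw [isOpen_iff]
  intro B x
  rw [isOpen_iff_mem_nhds]
  rintro 𝔭 ⟨𝔮, h𝔮, e⟩
  have hV : IsOpen (imagePt x ⁻¹' (V : Set (Pt X))) := V.isOpen.preimage (continuous_imagePt x)
  obtain ⟨f, hf, hfV⟩ := exists_basicOpen_subset hV (𝔭 := 𝔭) (by
    rw [mem_preimage, ← e]
    exact h.imagePt_mem 𝔮)
  obtain ⟨C, φ, hφ⟩ := exists_isLoc hf
  obtain ⟨χ, hχ⟩ := h.exists_hom (y := X.map φ x) fun 𝔯 => by
    rw [imagePt_map]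
    exact hfV (hφ.mem_basicOpen 𝔯)
  have hO := hφ.isOpenEmbedding.isOpenMap _ (hD.preimage (continuous_comp χ))
  refine Filter.mem_of_superset (hO.mem_nhds ?_) ?_
  · obtain ⟨𝔯, rfl⟩ := hφ.exists_prime hf
    refine ⟨𝔯, ?_, rfl⟩
    have : imagePt a (χ ≫ 𝔯) = imagePt a 𝔮 := by rw [← imagePt_map, hχ, imagePt_map, e]
    rw [mem_preimage, h.injective_imagePt this]
    exact h𝔮
  · rintro _ ⟨𝔯, h𝔯, rfl⟩
    exact ⟨χ ≫ 𝔯, h𝔯, by rw [← imagePt_map, hχ, imagePt_map]⟩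

theorem le_of_closedPt_mem {O : Opens (Pt X)} (hO : imagePt a (closedPt A) ∈ O) : V ≤ O := by
  intro x hx
  obtain ⟨𝔭, rfl⟩ := h.exists_prime hx
  exact mem_supported_of_closedPt hO 𝔭

theorem isPathConnected : IsPathConnected (V : Set (Pt X)) := by
  rw [← h.range_imagePt]
  exact isPathConnected_range (continuous_imagePt a)

/-- A chart restricts to a chart on the image of a basic open subset. -/
theorem of_isLoc {f : A} {B : AdmAlg.{u}} {φ : A ⟶ B} (hφ : IsLoc f φ) :
    IsAffineChart (X.map φ a) ⟨imagePt a '' basicOpen f,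
      h.isOpenEmbedding.isOpenMap _ (isOpen_basicOpen f)⟩ := by
  refine ⟨fun C χ χ' e => ?_, fun C y => ⟨?_, fun hy => ?_⟩⟩
  · dsimp only at e
    rw [← X.map_comp_apply, ← X.map_comp_apply] at e
    exact hφ.ext (h.hom_ext e)
  · rintro ⟨χ, rfl⟩ 𝔭
    exact ⟨φ ≫ χ ≫ 𝔭, hφ.mem_basicOpen _, by simp⟩
  · obtain ⟨ψ, rfl⟩ := h.exists_hom (y := y) fun 𝔭 => by
      obtain ⟨𝔮, -, e⟩ := hy 𝔭
      exact e ▸ h.imagePt_mem 𝔮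
    obtain ⟨χ, rfl⟩ := hφ.lift C ψ (isUnit_iff_forall_prime.2 fun 𝔭 => by
      obtain ⟨𝔮, h𝔮, e⟩ := hy 𝔭
      rw [imagePt_map] at e
      rwa [h.injective_imagePt e] at h𝔮)
    exact ⟨χ, by simp⟩

/-- The restriction map to a smaller chart is a localisation. -/
theorem exists_isLoc {B : AdmAlg.{u}} {b : X.obj B} {W : Opens (Pt X)} (h' : IsAffineChart b W)
    {φ : A ⟶ B} (hφ : X.map φ a = b) : ∃ f : A, IsLoc f φ := by
  have hW : IsOpen (imagePt a ⁻¹' (W : Set (Pt X))) := W.isOpen.preimage (continuous_imagePt a)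
  -- The basic open `D(f)` lies in `W` and contains the closed point of `W`, hence equals `W`; so
  -- `B` is the localisation at `f`.
  obtain ⟨f, hf, hfW⟩ := exists_basicOpen_subset hW (𝔭 := φ ≫ closedPt B) (by
    rw [mem_preimage, ← imagePt_map, hφ]
    exact h'.imagePt_mem _)
  obtain ⟨C, ι, hι⟩ := FOne.exists_isLoc hf
  obtain ⟨χ, hχ⟩ := h'.exists_hom (y := X.map ι a) fun 𝔯 => by
    rw [imagePt_map]
    exact hfW (hι.mem_basicOpen 𝔯)
  have e1 : φ ≫ χ = ι := h.hom_ext (by rw [X.map_comp_apply, hφ, hχ])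
  obtain ⟨φ', rfl⟩ := hι.lift B φ (ev_closedPt_ne_zero.1 hf)
  refine ⟨f, hι.of_iso φ' χ rfl (hι.ext (by rw [← Category.assoc, e1, Category.comp_id]))
    (h'.hom_ext ?_)⟩
  rw [X.map_comp_apply, hχ, ← X.map_comp_apply, hφ]
  simp

/-- A covering is trivial over each affine open subset. -/
theorem isGood {E : Type u} [TopologicalSpace E] {p : E → Pt X} (cov : IsCoveringMap p) :
    IsGood p (V : Set (Pt X)) := by
  classical
  refine ⟨V.isOpen, h.isPathConnected, fun e he => ?_⟩
  obtain ⟨-, U, hx, hU, -, H, hH⟩ := cov (imagePt a (closedPt A))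
  -- An evenly covered neighbourhood of the closed point contains all of `V`. The sections are the
  -- horizontal ones of the trivialisation, with the irrelevant value `e` outside `U`.
  have hVU : (V : Set (Pt X)) ⊆ U := h.le_of_closedPt_mem (O := ⟨U, hU⟩) hx
  have heU : p e ∈ U := hVU he
  refine ⟨fun x => if hx : x ∈ U then (H.symm (⟨x, hx⟩, (H ⟨e, heU⟩).2)).1 else e,
    ⟨?_, fun x hx => ?_⟩, ?_⟩
  · refine ContinuousOn.mono ?_ hVU
    rw [continuousOn_iff_continuous_domRestrict]
    have : Continuous fun x : U => (H.symm (x, (H ⟨e, heU⟩).2)).1 := by fun_prop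
    convert this using 1
    ext x
    simp
  · simp only [hVU hx, dite_true]
    rw [← hH]
    simp
  · simp only [heU, dite_true]
    have : (⟨p e, heU⟩ : U) = (H ⟨e, heU⟩).1 := Subtype.ext (hH ⟨e, heU⟩).symm
    rw [this]
    simp

end IsAffineChart

theorem IsFormalScheme.exists_chart {X : FPsh.{u}} (hX : IsFormalScheme X) {x : Pt X}
    {O : Set (Pt X)} (hO : O ∈ 𝓝 x) : ∃ (A : AdmAlg.{u}) (a : X.obj A) (V : Opens (Pt X)),
      IsAffineChart a V ∧ x ∈ V ∧ (V : Set (Pt X)) ⊆ O := by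
  obtain ⟨O', hO', hOo, hx⟩ := mem_nhds_iff.1 hO
  obtain ⟨A, a, V, h, hxV⟩ := hX pt x
  obtain ⟨𝔭, rfl⟩ := h.exists_prime (by simpa only [imagePt_id, SetLike.mem_coe] using hxV (𝟙 pt))
  obtain ⟨f, hf, hfO⟩ := exists_basicOpen_subset (hOo.preimage (continuous_imagePt a)) hx
  obtain ⟨C, ι, hι⟩ := exists_isLoc hf
  refine ⟨C, _, _, h.of_isLoc hι, ⟨𝔭, hf, rfl⟩, ?_⟩
  rintro _ ⟨𝔮, h𝔮, rfl⟩
  exact hO' (hfO h𝔮)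

theorem IsFormalScheme.exists_isGood {X : FPsh.{u}} (hX : IsFormalScheme X) {E : Type u}
    [TopologicalSpace E] {p : E → Pt X} (cov : IsCoveringMap p) (x : Pt X) (O : Set (Pt X))
    (hO : O ∈ 𝓝 x) : ∃ U ⊆ O, x ∈ U ∧ IsGood p U := by
  obtain ⟨A, a, V, h, hx, hV⟩ := hX.exists_chart hO
  exact ⟨V, hV, hx, h.isGood cov⟩

/-! ### Fraction groups and localisation -/

section Frac

variable {A B C : AdmAlg.{u}}

/-- A homomorphism with zero kernel, on nonzero elements. -/
noncomputable def nzMap (hB : IsCancelMulZero B) (φ : A ⟶ B) (hφ : ∀ a, AdmAlg.ev φ a = 0 → a = 0) :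
    nonZeroDivisors A →* nonZeroDivisors B :=
  ((AdmAlg.ev φ : A →* B).comp (nonZeroDivisors A).subtype).codRestrict _ fun f =>
    mem_nonZeroDivisors_of_ne_zero fun hf => nonZeroDivisors.coe_ne_zero f (hφ _ hf)

/-- The homomorphism on fraction groups induced by a homomorphism with zero kernel. -/
noncomputable def fracMap (hB : IsCancelMulZero B) (φ : A ⟶ B)
    (hφ : ∀ a, AdmAlg.ev φ a = 0 → a = 0) : FracGroup A →* FracGroup B :=
  Algebra.GrothendieckGroup.lift (Algebra.GrothendieckGroup.of.comp (nzMap hB φ hφ))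

@[simp] theorem fracMap_of (hB : IsCancelMulZero B) (φ : A ⟶ B)
    (hφ : ∀ a, AdmAlg.ev φ a = 0 → a = 0) (a : nonZeroDivisors A) :
    fracMap hB φ hφ (Algebra.GrothendieckGroup.of a) =
      Algebra.GrothendieckGroup.of (nzMap hB φ hφ a) :=
  DFunLike.congr_fun (Algebra.GrothendieckGroup.lift.symm_apply_apply _) a

theorem frac_hom_ext {G : Type*} [CommGroup G] {f g : FracGroup A →* G}
    (h : ∀ a : nonZeroDivisors A, f (Algebra.GrothendieckGroup.of a) =
      g (Algebra.GrothendieckGroup.of a)) : f = g :=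
  Algebra.GrothendieckGroup.lift.symm.injective (MonoidHom.ext h)

theorem frac_exists (x : FracGroup A) : ∃ a b : nonZeroDivisors A,
    x = Algebra.GrothendieckGroup.of a / Algebra.GrothendieckGroup.of b := by
  obtain ⟨⟨a, b⟩, h⟩ := (Localization.monoidOf (⊤ : Submonoid (nonZeroDivisors A))).surj x
  exact ⟨a, b, eq_div_iff_mul_eq'.2 h⟩

theorem fracMap_comp (hB : IsCancelMulZero B) (hC : IsCancelMulZero C) (φ : A ⟶ B) (ψ : B ⟶ C)
    (hφ : ∀ a, AdmAlg.ev φ a = 0 → a = 0) (hψ : ∀ a, AdmAlg.ev ψ a = 0 → a = 0)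
    (h : ∀ a, AdmAlg.ev (φ ≫ ψ) a = 0 → a = 0) (x : FracGroup A) :
    fracMap hC ψ hψ (fracMap hB φ hφ x) = fracMap hC (φ ≫ ψ) h x := by
  refine DFunLike.congr_fun (f := (fracMap hC ψ hψ).comp (fracMap hB φ hφ))
    (frac_hom_ext fun a => ?_) x
  simp only [MonoidHom.comp_apply, fracMap_of]
  rfl

/-- If two elements become equal, either cancelling a power of `f` shows that they were equal, or
both become zero, and then both are zero because the kernel is. -/
theorem IsLoc.injective {f : A} {φ : A ⟶ B} (h : IsLoc f φ) (hA : IsCancelMulZero A)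
    (hφ : ∀ a, AdmAlg.ev φ a = 0 → a = 0) : Function.Injective (AdmAlg.ev φ) := by
  intro a a' e
  have hf : f ≠ 0 := by
    rintro rfl
    exact h.isUnit.ne_zero (map_zero _)
  obtain ⟨n, hn⟩ | h0 := h.eq_or a a' e
  · exact mul_right_cancel₀ (pow_ne_zero n hf) hn
  · rw [hφ a h0, hφ a' (e ▸ h0)]

/-- An element of the localisation is a fraction `a / f ^ n`, so localising creates no new
fractions; injectivity on elements passes to the fraction groups by cancellation. -/
theorem IsLoc.bijective_fracMap {f : A} {φ : A ⟶ B} (h : IsLoc f φ) (hA : IsCancelMulZero A)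
    (hB : IsCancelMulZero B) (hφ : ∀ a, AdmAlg.ev φ a = 0 → a = 0) :
    Function.Bijective (fracMap hB φ hφ) := by
  have hf : f ≠ 0 := by
    rintro rfl
    exact h.isUnit.ne_zero (map_zero _)
  constructor
  · rw [injective_iff_map_eq_one]
    intro x hx
    obtain ⟨a, b, rfl⟩ := frac_exists x
    rw [map_div, fracMap_of, fracMap_of, div_eq_one] at hx
    have : IsCancelMul (nonZeroDivisors B) :=
      { mul_left_cancel := fun a b c e => Subtype.ext
          (mul_left_cancel₀ (nonZeroDivisors.coe_ne_zero a) (congrArg Subtype.val e))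
        mul_right_cancel := fun a b c e => Subtype.ext
          (mul_right_cancel₀ (nonZeroDivisors.coe_ne_zero a) (congrArg Subtype.val e)) }
    have := congrArg Subtype.val (Algebra.GrothendieckGroup.of_injective hx)
    rw [Subtype.ext (h.injective hA hφ this), div_self']
  · have key : ∀ b : nonZeroDivisors B,
        Algebra.GrothendieckGroup.of b ∈ (fracMap hB φ hφ).range := by
      intro b
      obtain ⟨n, a, e⟩ := h.surj b
      have ha : a ≠ 0 := by
        rintro rfl
        rw [map_zero] at e
        exact mul_ne_zero (nonZeroDivisors.coe_ne_zero b) (pow_ne_zero n h.isUnit.ne_zero) e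
      let a' : nonZeroDivisors A := ⟨a, mem_nonZeroDivisors_of_ne_zero ha⟩
      let f' : nonZeroDivisors A := ⟨f, mem_nonZeroDivisors_of_ne_zero hf⟩
      refine ⟨Algebra.GrothendieckGroup.of a' / Algebra.GrothendieckGroup.of (f' ^ n), ?_⟩
      rw [map_div, fracMap_of, fracMap_of, div_eq_iff_eq_mul, ← map_mul]
      refine congrArg _ (Subtype.ext ?_)
      change AdmAlg.ev φ a = b * AdmAlg.ev φ (f ^ n)
      rw [map_pow, e]
    intro x
    obtain ⟨a, b, rfl⟩ := frac_exists x
    exact div_mem (key a) (key b)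

end Frac

end FOne

namespace FOne

open Set Topology Filter

/-! ### Étalé spaces and monodromy by group automorphisms -/

section Germs

variable {T : TopCat.{u}} {F : TopCat.Presheaf CommGrpCat.{u} T}

/-- The stalk may be computed on arbitrarily small neighbourhoods to which restriction is bijective.
-/
theorem bijective_germ {U : Opens T} {x : T} (hx : x ∈ U)
    (h : ∀ O : Opens T, x ∈ O → ∃ (V : Opens T) (hV : V ≤ U), x ∈ V ∧ V ≤ O ∧
      Function.Bijective (F.map (homOfLE hV).op)) : Function.Bijective (F.germ U x hx) := by
  constructor
  · intro s t hst
    obtain ⟨W, hxW, iU, iU', e⟩ := F.germ_eq x hx hx s t hst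
    obtain ⟨V, hV, hxV, hVW, hb⟩ := h W hxW
    refine hb.1 ?_
    have := congrArg (F.map (homOfLE hVW).op) e
    rw [← F.map_comp_apply, ← F.map_comp_apply] at this
    exact this
  · intro g
    obtain ⟨O, hxO, s, rfl⟩ := F.exists_germ_eq g
    obtain ⟨V, hV, hxV, hVO, hb⟩ := h O hxO
    obtain ⟨t, ht⟩ := hb.2 (F.map (homOfLE hVO).op s)
    refine ⟨t, ?_⟩
    rw [← F.germ_res_apply (homOfLE hV) x hxV t, ht, F.germ_res_apply]

theorem continuous_etaleSpace {A : Type*} [TopologicalSpace A] {g : A → F.EtaleSpace}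
    (hb : Continuous fun a => (g a).base)
    (h : ∀ a, ∃ (U : Opens T) (s : F.obj (op U)), (g a).base ∈ U ∧
      ∀ᶠ a' in 𝓝 a, ∃ hU : (g a').base ∈ U, (g a').germ = F.germ U _ hU s) : Continuous g := by
  rw [continuous_iff_continuousAt]
  intro a
  obtain ⟨U, s, ha, hs⟩ := h a
  simp only [ContinuousAt, nhds_generateFrom, tendsto_iInf, mem_ofPred_eq, tendsto_principal]
  rintro _ ⟨hmem, V, f, rfl⟩
  obtain ⟨hV, hf⟩ := hmem
  obtain ⟨hU, hs'⟩ := hs.self_of_nhds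
  obtain ⟨W, hW, ιU, ιV, e⟩ := F.germ_eq _ hU hV s f (hs'.symm.trans hf)
  filter_upwards [hs, hb.continuousAt.eventually (W.isOpen.mem_nhds hW)] with a' ⟨h1, h2⟩ h3
  refine ⟨ιV.le h3, ?_⟩
  rw [h2, ← F.germ_res_apply ιU _ h3, e, F.germ_res_apply]

/-- The product of two germs at the same point. -/
noncomputable def mulGerm (e₁ e₂ : F.EtaleSpace) (h : e₂.base = e₁.base) : F.EtaleSpace :=
  ⟨e₁.base, e₁.germ * (h ▸ e₂.germ)⟩

theorem mulGerm_eq {e₁ e₂ : F.EtaleSpace} {h : e₂.base = e₁.base} {x : T} {k l : F.stalk x}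
    (h₁ : e₁ = ⟨x, k⟩) (h₂ : e₂ = ⟨x, l⟩) : mulGerm e₁ e₂ h = ⟨x, k * l⟩ := by
  subst h₁ h₂
  rfl

theorem exists_mulGerm_germ {e₁ e₂ : F.EtaleSpace} {U V : Opens T} {s : F.obj (op U)}
    {t : F.obj (op V)} (h₁ : e₁.base ∈ U) (h₁' : e₁.germ = F.germ U e₁.base h₁ s)
    (h₂ : e₂.base ∈ V) (h₂' : e₂.germ = F.germ V e₂.base h₂ t) (h : e₂.base = e₁.base) :
    ∃ hUV : (mulGerm e₁ e₂ h).base ∈ U ⊓ V, (mulGerm e₁ e₂ h).germ = F.germ (U ⊓ V) _ hUV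
      (F.map (homOfLE inf_le_left).op s * F.map (homOfLE inf_le_right).op t) := by
  obtain ⟨x, k⟩ := e₁
  obtain ⟨y, l⟩ := e₂
  obtain rfl : y = x := h
  replace h₁ : y ∈ U := h₁
  replace h₂ : y ∈ V := h₂
  obtain rfl : k = F.germ U y h₁ s := h₁'
  obtain rfl : l = F.germ V y h₂ t := h₂'
  have hUV : y ∈ U ⊓ V := ⟨h₁, h₂⟩
  refine ⟨hUV, ?_⟩
  change _ = F.germ (U ⊓ V) y hUV _
  rw [map_mul, F.germ_res_apply, F.germ_res_apply]
  rfl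

theorem continuous_mulGerm {A : Type*} [TopologicalSpace A] {g₁ g₂ : A → F.EtaleSpace}
    (h₁ : Continuous g₁) (h₂ : Continuous g₂) (h : ∀ a, (g₂ a).base = (g₁ a).base) :
    Continuous fun a => mulGerm (g₁ a) (g₂ a) (h a) := by
  have hb : Continuous fun a => (g₁ a).base :=
    (TopCat.Presheaf.EtaleSpace.continuous_base F).comp h₁
  refine continuous_etaleSpace hb fun a => ?_
  obtain ⟨U, hU, s, hs⟩ := TopCat.Presheaf.EtaleSpace.exists_section_of_tendsto
    h₁.continuousAt.tendsto
  obtain ⟨V, hV, t, ht⟩ := TopCat.Presheaf.EtaleSpace.exists_section_of_tendsto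
    h₂.continuousAt.tendsto
  refine ⟨U ⊓ V, F.map (homOfLE inf_le_left).op s * F.map (homOfLE inf_le_right).op t,
    ⟨hU, h a ▸ hV⟩, ?_⟩
  filter_upwards [hs, ht] with a' ⟨h1, h2⟩ ⟨h3, h4⟩
  exact exists_mulGerm_germ h1 h2 h3 h4 (h a')

theorem continuous_etaleSpace_germ {A : Type*} [TopologicalSpace A] {b : A → T}
    (hb : Continuous b) {U : Opens T} (hU : ∀ a, b a ∈ U) (s : F.obj (op U)) :
    Continuous fun a => (⟨b a, F.germ U (b a) (hU a) s⟩ : F.EtaleSpace) :=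
  continuous_etaleSpace hb fun a => ⟨U, s, hU a, .of_forall fun a' => ⟨hU a', rfl⟩⟩

/-- The fibre of the étalé space is the stalk. -/
def fiberEquiv (F : TopCat.Presheaf CommGrpCat.{u} T) (x : T) :
    F.stalk x ≃ (TopCat.Presheaf.EtaleSpace.base (F := F) ⁻¹' {x} : Set F.EtaleSpace) where
  toFun k := ⟨⟨x, k⟩, rfl⟩
  invFun e := (show e.1.base = x from e.2) ▸ e.1.germ
  left_inv _ := rfl
  right_inv := by
    rintro ⟨⟨y, k⟩, rfl : y = x⟩
    rfl

/-- The pointwise product of two lifts of a path is continuous, hence is the lift that starts at the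
product of the germs. -/
theorem monodromy_mul (hF : IsLocalSystem F) {x y : T} (γ : Path.Homotopic.Quotient x y)
    {k l : F.stalk x} {m n : F.stalk y}
    (h₁ : ((TopCat.Presheaf.EtaleSpace.isCoveringMap_base hF).monodromy γ
      (fiberEquiv F x k)) = fiberEquiv F y m)
    (h₂ : ((TopCat.Presheaf.EtaleSpace.isCoveringMap_base hF).monodromy γ
      (fiberEquiv F x l)) = fiberEquiv F y n) :
    ((TopCat.Presheaf.EtaleSpace.isCoveringMap_base hF).monodromy γ
      (fiberEquiv F x (k * l))) = fiberEquiv F y (m * n) := by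
  obtain ⟨γ⟩ := γ
  set cov := TopCat.Presheaf.EtaleSpace.isCoveringMap_base hF
  have hγ : ∀ m : F.stalk x, γ 0 = (fiberEquiv F x m).1.base := fun m => γ.source
  let L := fun m : F.stalk x => cov.liftPath γ.toContinuousMap (fiberEquiv F x m).1 (hγ m)
  have hL : ∀ m t, (L m t).base = γ t := fun m t => congrFun (cov.liftPath_lifts ..) t
  have hL0 : ∀ m, L m 0 = ⟨x, m⟩ := fun m => cov.liftPath_zero ..
  have hLL : ∀ t, (L l t).base = (L k t).base := fun t => (hL _ _).trans (hL _ _).symm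
  have key : (fun t => mulGerm (L k t) (L l t) (hLL t)) = L (k * l) := by
    rw [cov.eq_liftPath_iff]
    refine ⟨continuous_mulGerm (L k).continuous (L l).continuous _, funext fun t => hL _ _, ?_⟩
    exact mulGerm_eq (hL0 k) (hL0 l)
  refine Subtype.ext ?_
  change L (k * l) 1 = _
  rw [← key]
  exact mulGerm_eq (congrArg Subtype.val h₁) (congrArg Subtype.val h₂)

/-- The monodromy action on the stalk by group automorphisms. -/
noncomputable def monodromyHom (hF : IsLocalSystem F) (x : T) :
    FundamentalGroup T x →* MulAut (F.stalk x) where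
  toFun γ :=
    { ((fiberEquiv F x).trans
        ((TopCat.Presheaf.EtaleSpace.isCoveringMap_base hF).monodromyPerm x γ)).trans
        (fiberEquiv F x).symm with
      map_mul' := fun k l => by
        refine (Equiv.symm_apply_eq (fiberEquiv F x)).2 ?_
        exact monodromy_mul hF γ ((fiberEquiv F x).apply_symm_apply _).symm
          ((fiberEquiv F x).apply_symm_apply _).symm }
  map_one' := by
    ext k
    change (fiberEquiv F x).symm
      ((TopCat.Presheaf.EtaleSpace.isCoveringMap_base hF).monodromyPerm x 1 _) = k
    rw [map_one]
    exact (fiberEquiv F x).symm_apply_apply k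
  map_mul' γ δ := by
    ext k
    refine (Equiv.symm_apply_eq (fiberEquiv F x)).2 ?_
    change ((TopCat.Presheaf.EtaleSpace.isCoveringMap_base hF).monodromyPerm x (γ * δ) _) =
      fiberEquiv F x ((fiberEquiv F x).symm
      ((TopCat.Presheaf.EtaleSpace.isCoveringMap_base hF).monodromyPerm x γ
        (fiberEquiv F x ((fiberEquiv F x).symm
      ((TopCat.Presheaf.EtaleSpace.isCoveringMap_base hF).monodromyPerm x δ _)))))
    rw [Equiv.apply_symm_apply, Equiv.apply_symm_apply, map_mul]
    rfl

theorem fiberEquiv_monodromyHom (hF : IsLocalSystem F) (x : T) (γ : FundamentalGroup T x)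
    (k : F.stalk x) : fiberEquiv F x (monodromyHom hF x γ k) =
      (TopCat.Presheaf.EtaleSpace.isCoveringMap_base hF).monodromyPerm x γ (fiberEquiv F x k) :=
  (fiberEquiv F x).apply_symm_apply _

theorem isMonodromyAction_monodromyHom (hF : IsLocalSystem F) (x : T) :
    IsMonodromyAction hF x (monodromyHom hF x) :=
  fun γ k => (fiberEquiv_monodromyHom hF x γ k).symm

theorem ker_monodromyHom (hF : IsLocalSystem F) (x : T) : (monodromyHom hF x).ker =
    ((TopCat.Presheaf.EtaleSpace.isCoveringMap_base hF).monodromyPerm x).ker := by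
  ext γ
  rw [MonoidHom.mem_ker, MonoidHom.mem_ker, MulEquiv.ext_iff, Equiv.ext_iff,
    (fiberEquiv F x).surjective.forall]
  refine forall_congr' fun k => ?_
  rw [← fiberEquiv_monodromyHom]
  exact (fiberEquiv F x).injective.eq_iff.symm

end Germs

/-! ### The sheaf `K_X^×` is locally constant -/

section CharSheaf

variable {X : FPsh.{u}} (hI : IsIntegral X)

/-- The homomorphism on fraction groups induced by a morphism of charts. -/
noncomputable def chartFrac {A B : AdmAlg.{u}} {a : X.obj A} {b : X.obj B} {V W : Opens (Pt X)}
    (h : IsAffineChart a V) (h' : IsAffineChart b W) (φ : A ⟶ B) (e : X.map φ a = b) :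
    FracGroup A →* FracGroup B := fracMap (hI.cancel h') φ (hI.nonboundary h h' φ e)

variable {A B C : AdmAlg.{u}} {a : X.obj A} {b : X.obj B} {c : X.obj C} {U V W : Opens (Pt X)}
    (ha : IsAffineChart a U) (hb : IsAffineChart b V) (hc : IsAffineChart c W)

theorem chartFrac_chartFrac {φ : A ⟶ B} {ψ : B ⟶ C} {χ : A ⟶ C} (e : X.map φ a = b)
    (e' : X.map ψ b = c) (e'' : X.map χ a = c) (k : FracGroup A) :
    chartFrac hI hb hc ψ e' (chartFrac hI ha hb φ e k) = chartFrac hI ha hc χ e'' k := by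
  obtain rfl : φ ≫ ψ = χ := ha.hom_ext (by rw [X.map_comp_apply, e, e', e''])
  exact fracMap_comp ..

theorem bijective_chartFrac {φ : A ⟶ B} (e : X.map φ a = b) :
    Function.Bijective (chartFrac hI ha hb φ e) := by
  obtain ⟨f, hf⟩ := ha.exists_isLoc hb e
  exact hf.bijective_fracMap (hI.cancel ha) (hI.cancel hb) _

theorem incl_mem_supported {W : AffineOpens X} (hW : W.1 ≤ U) :
    W.incl ∈ (supported X U).obj W.ring :=
  fun 𝔭 => hW (W.isAffineChart.imagePt_mem 𝔭)

include ha in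
theorem exists_res_of_le {W : AffineOpens X} (hW : W.1 ≤ U) : ∃ φ : A ⟶ W.ring,
    X.map φ a = W.incl := ha.exists_hom (incl_mem_supported hW)

/-- The section of the sheaf `K_X^×` over a chart given by an element of the fraction group. -/
noncomputable def chartSection : FracGroup A →* charSections hI U where
  toFun k := ⟨fun W => chartFrac hI ha W.1.isAffineChart _ (exists_res_of_le ha W.2).choose_spec k,
    fun V W h => chartFrac_chartFrac hI ha W.1.isAffineChart V.1.isAffineChart _
      (AffineOpens.map_res h) _ k⟩
  map_one' := Subtype.ext (funext fun _ => map_one _)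
  map_mul' _ _ := Subtype.ext (funext fun _ => map_mul _ _ _)

theorem chartSection_apply (k : FracGroup A) (W : AffineOpens X) (hW : W.1 ≤ U) (φ : A ⟶ W.ring)
    (e : X.map φ a = W.incl) :
    (chartSection hI ha k).1 ⟨W, hW⟩ = chartFrac hI ha W.isAffineChart φ e k := by
  obtain rfl := ha.hom_ext (e.trans (exists_res_of_le ha hW).choose_spec.symm)
  rfl

theorem bijective_chartSection : Function.Bijective (chartSection hI ha) := by
  -- This is `U` with its chosen coordinate algebra, which need not be `A`. A section over `U` is
  -- determined by its value there.
  let W : AffineOpens X := ⟨U, A, a, ha⟩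
  obtain ⟨φ, e⟩ := exists_res_of_le (W := W) ha le_rfl
  have hb := bijective_chartFrac hI ha W.isAffineChart e
  constructor
  · intro k l h
    refine hb.1 ?_
    have := congrArg (fun s => s.1 ⟨W, le_rfl⟩) h
    simp only [chartSection_apply hI ha _ W le_rfl φ e] at this
    exact this
  · intro s
    obtain ⟨k, hk⟩ := hb.2 (s.1 ⟨W, le_rfl⟩)
    refine ⟨k, Subtype.ext (funext fun V => ?_)⟩
    obtain ⟨ψ, hψ⟩ := exists_res_of_le ha V.2
    rw [← s.2 V ⟨W, le_rfl⟩ V.2, ← hk, chartSection_apply hI ha k V.1 V.2 ψ hψ]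
    exact (chartFrac_chartFrac hI ha W.isAffineChart V.1.isAffineChart e (AffineOpens.map_res V.2)
      hψ k).symm

theorem map_chartSection (hV : V ≤ U) {φ : A ⟶ B} (e : X.map φ a = b) (k : FracGroup A) :
    (charSheaf hI).map (homOfLE hV).op (chartSection hI ha k) =
      chartSection hI hb (chartFrac hI ha hb φ e k) := by
  refine Subtype.ext (funext fun W => ?_)
  obtain ⟨ψ, hψ⟩ := exists_res_of_le hb W.2
  rw [chartSection_apply hI hb _ W.1 W.2 ψ hψ, chartFrac_chartFrac hI ha hb W.1.isAffineChart e hψ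
    (χ := φ ≫ ψ) (by rw [X.map_comp_apply, e, hψ])]
  exact chartSection_apply hI ha k W.1 (W.2.trans hV) _ _

include ha in
theorem isConstantOn_chart (hX : IsFormalScheme X) : IsConstantOn (charSheaf hI) U := by
  intro x hx
  refine bijective_germ hx fun O hO => ?_
  obtain ⟨B, b, V, hb, hxV, hV⟩ := hX.exists_chart ((U ⊓ O).isOpen.mem_nhds ⟨hx, hO⟩)
  have hVU : V ≤ U := hV.trans inf_le_left
  refine ⟨V, hVU, hxV, hV.trans inf_le_right, ?_⟩
  obtain ⟨φ, e⟩ := ha.exists_hom (y := b) fun 𝔭 => hVU (hb.imagePt_mem 𝔭)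
  have h1 := (bijective_chartSection hI hb).comp (bijective_chartFrac hI ha hb e)
  have h2 : chartSection hI hb ∘ chartFrac hI ha hb φ e =
      ((charSheaf hI).map (homOfLE hVU).op : _ → _) ∘ (chartSection hI ha) :=
    funext fun k => (map_chartSection hI ha hb hVU e k).symm
  rw [h2] at h1
  exact (Function.Bijective.of_comp_iff _ (bijective_chartSection hI ha)).1 h1

theorem isLocalSystem_charSheaf (hX : IsFormalScheme X) : IsLocalSystem (charSheaf hI) := by
  intro x
  obtain ⟨A, a, U, ha, hx, -⟩ := hX.exists_chart (x := x) univ_mem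
  exact ⟨U, hx, isConstantOn_chart hI ha hX⟩

/-- The germ of an element of the fraction group of a chart. -/
noncomputable def chartGerm {x : Pt X} (hx : x ∈ U) : FracGroup A →* (charSheaf hI).stalk x :=
  ((charSheaf hI).germ U x hx).hom.comp (chartSection hI ha)

theorem bijective_chartGerm (hX : IsFormalScheme X) {x : Pt X} (hx : x ∈ U) :
    Function.Bijective (chartGerm hI ha hx) :=
  (isConstantOn_chart hI ha hX x hx).comp (bijective_chartSection hI ha)

theorem chartGerm_chartFrac (hV : V ≤ U) {φ : A ⟶ B} (e : X.map φ a = b) {x : Pt X} (hx : x ∈ V)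
    (k : FracGroup A) :
    chartGerm hI hb hx (chartFrac hI ha hb φ e k) = chartGerm hI ha (hV hx) k := by
  change (charSheaf hI).germ V x hx (chartSection hI hb (chartFrac hI ha hb φ e k)) =
    (charSheaf hI).germ U x (hV hx) (chartSection hI ha k)
  rw [← map_chartSection hI ha hb hV e]
  exact TopCat.Presheaf.germ_res_apply (X := space X) (charSheaf hI) (homOfLE hV) x hx _

end CharSheaf

end FOne

namespace FOne

open Set Topology Filter

/-! ### Fibre product of a formal scheme with a covering of its space -/

section Pullback

theorem continuous_iff_imagePt {X : FPsh.{u}} {Z : Type*} [TopologicalSpace Z] {f : Pt X → Z} :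
    Continuous f ↔ ∀ (A : AdmAlg.{u}) (x : X.obj A), Continuous fun 𝔭 => f (imagePt x 𝔭) := by
  refine ⟨fun h A x => h.comp (continuous_imagePt x), fun h => ⟨fun O hO => ?_⟩⟩
  exact isOpen_iff.2 fun A x => hO.preimage (h A x)

theorem IsSectionOn.isOpen_image {T E : Type u} [TopologicalSpace T] [TopologicalSpace E]
    {p : E → T} (cov : IsCoveringMap p) {U : Set T} {σ : T → E} (h : IsSectionOn p U σ)
    (hU : IsOpen U) : IsOpen (σ '' U) := by
  rw [isOpen_iff_mem_nhds]
  rintro _ ⟨x, hx, rfl⟩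
  obtain ⟨N, hN, hxN, hinj⟩ := cov.isLocalHomeomorph.isLocallyInjective (σ x)
  have hc : ContinuousAt (fun e => σ (p e)) (σ x) := by
    refine ContinuousAt.comp (f := p) ?_ cov.continuous.continuousAt
    rw [h.2 x hx]
    exact h.1.continuousAt (hU.mem_nhds hx)
  have hpU : p (σ x) ∈ U := by rwa [h.2 x hx]
  filter_upwards [hN.mem_nhds hxN, (hU.preimage cov.continuous).mem_nhds hpU,
    hc.eventually (by simp only [h.2 x hx]; exact hN.mem_nhds hxN)] with e h1 h2 h3
  exact ⟨p e, h2, hinj h3 h1 (h.2 _ h2)⟩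

theorem IsSectionOn.eqOn {T E : Type u} [TopologicalSpace T] [TopologicalSpace E]
    {p : E → T} (cov : IsCoveringMap p) {U : Set T} {σ τ : T → E} (hσ : IsSectionOn p U σ)
    (hτ : IsSectionOn p U τ) (hU : IsPreconnected U) {x : T} (hx : x ∈ U) (e : σ x = τ x) :
    EqOn σ τ U :=
  cov.eqOn_of_comp_eqOn hU hσ.1 hτ.1 (fun y hy => (hσ.2 y hy).trans (hτ.2 y hy).symm) hx e

variable (X : FPsh.{u}) {P : Type u} [TopologicalSpace P] (q : P → Pt X)

/-- The fibre product of `X` with a covering of its underlying space. -/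
def pullback : FPsh.{u} where
  obj B := {y : X.obj B × (Prime B → P) // Continuous y.2 ∧ ∀ 𝔭, q (y.2 𝔭) = imagePt y.1 𝔭}
  map φ := ↾fun y => ⟨(X.map φ y.1.1, fun 𝔭 => y.1.2 (φ ≫ 𝔭)), y.2.1.comp (continuous_comp φ),
    fun 𝔭 => by rw [y.2.2, imagePt_map]⟩
  map_id A := by
    refine ConcreteCategory.hom_ext _ _ fun y => Subtype.ext (Prod.ext ?_ ?_)
    · exact X.map_id_apply A y.1.1
    · exact funext fun 𝔭 => congrArg y.1.2 (Category.id_comp 𝔭)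
  map_comp φ ψ := by
    refine ConcreteCategory.hom_ext _ _ fun y => Subtype.ext (Prod.ext ?_ ?_)
    · exact X.map_comp_apply φ ψ y.1.1
    · exact funext fun 𝔭 => congrArg y.1.2 (Category.assoc φ ψ 𝔭)

/-- The projection of the fibre product. -/
def pullbackFst : pullback X q ⟶ X where
  app B := ↾fun y => y.1.1

variable {X q}

/-- The element of the fibre product given by a lift. -/
def pullbackMk {B : AdmAlg.{u}} (x : X.obj B) (s : Prime B → P) (hs : Continuous s)
    (h : ∀ 𝔭, q (s 𝔭) = imagePt x 𝔭) : (pullback X q).obj B := ⟨(x, s), hs, h⟩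

/-- The lift belonging to an element of the fibre product. -/
def pullbackLift {B : AdmAlg.{u}} (y : (pullback X q).obj B) : Prime B → P := y.1.2

theorem continuous_pullbackLift {B : AdmAlg.{u}} (y : (pullback X q).obj B) :
    Continuous (pullbackLift y) := y.2.1

theorem apply_pullbackLift {B : AdmAlg.{u}} (y : (pullback X q).obj B) (𝔭 : Prime B) :
    q (pullbackLift y 𝔭) = imagePt ((pullbackFst X q).app B y) 𝔭 := y.2.2 𝔭

theorem pullback_ext {B : AdmAlg.{u}} {y z : (pullback X q).obj B}
    (h : (pullbackFst X q).app B y = (pullbackFst X q).app B z)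
    (h' : ∀ 𝔭, pullbackLift y 𝔭 = pullbackLift z 𝔭) : y = z :=
  Subtype.ext (Prod.ext h (funext h'))

@[simp] theorem pullbackLift_map {B C : AdmAlg.{u}} (φ : B ⟶ C) (y : (pullback X q).obj B)
    (𝔭 : Prime C) : pullbackLift ((pullback X q).map φ y) 𝔭 = pullbackLift y (φ ≫ 𝔭) := rfl

@[simp] theorem pullbackFst_map {B C : AdmAlg.{u}} (φ : B ⟶ C) (y : (pullback X q).obj B) :
    (pullbackFst X q).app C ((pullback X q).map φ y) = X.map φ ((pullbackFst X q).app B y) := rfl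

/-- The point of the covering below a point of the fibre product. -/
def pullbackPt (y : Pt (pullback X q)) : P := pullbackLift (B := pt) y (𝟙 pt)

@[simp] theorem pullbackPt_imagePt {B : AdmAlg.{u}} (y : (pullback X q).obj B) (𝔭 : Prime B) :
    pullbackPt (imagePt y 𝔭) = pullbackLift y 𝔭 := by
  unfold pullbackPt imagePt
  rw [pullbackLift_map, Category.comp_id]

theorem apply_pullbackPt (y : Pt (pullback X q)) :
    q (pullbackPt y) = mapPt (pullbackFst X q) y := by
  refine (apply_pullbackLift (B := pt) y (𝟙 pt)).trans ?_
  exact imagePt_id _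

theorem continuous_pullbackPt : Continuous (pullbackPt (X := X) (q := q)) := by
  rw [continuous_iff_imagePt]
  intro A y
  simp only [pullbackPt_imagePt]
  exact continuous_pullbackLift y

theorem bijective_pullbackPt : Function.Bijective (pullbackPt (X := X) (q := q)) := by
  constructor
  · intro y z h
    refine pullback_ext (B := pt) ?_ fun 𝔭 => ?_
    · have := congrArg q h
      rwa [apply_pullbackPt (q := q), apply_pullbackPt (q := q)] at this
    · rw [Subsingleton.elim 𝔭 (𝟙 pt)]
      exact h
  · intro e
    exact ⟨pullbackMk (B := pt) (q e) (fun _ => e) continuous_const fun 𝔭 => (imagePt_pt _ 𝔭).symm,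
      rfl⟩

section Chart

variable {A : AdmAlg.{u}} {a : X.obj A} {V : Opens (Pt X)} (h : IsAffineChart a V) {σ : Pt X → P}
  (hσ : IsSectionOn q V σ)

/-- The lift of a chart along a section of the covering. -/
def sectionLift {B : AdmAlg.{u}} (x : X.obj B) (hx : x ∈ (supported X V).obj B) :
    (pullback X q).obj B :=
  pullbackMk x (fun 𝔭 => σ (imagePt x 𝔭))
    (hσ.1.comp_continuous (continuous_imagePt x) hx) fun 𝔭 => hσ.2 _ (hx 𝔭)

/-- The open subset given by a section of the covering. -/
def sectionOpens (cov : IsCoveringMap q) : Opens (Pt (pullback X q)) :=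
  ⟨pullbackPt ⁻¹' (σ '' V), (hσ.isOpen_image cov V.isOpen).preimage continuous_pullbackPt⟩

variable (cov : IsCoveringMap q)

include h in
-- A morphism to the fibre product whose lift lands in `σ '' V` has a lift forced by its image in
-- `X`, so it amounts to a morphism to the chart of `X`.
theorem isAffineChart_sectionLift : IsAffineChart (sectionLift hσ a h.mem_supported_self)
    (sectionOpens hσ cov) := by
  refine ⟨fun B φ ψ e => h.hom_ext (congrArg ((pullbackFst X q).app B) e), fun B y => ⟨?_, ?_⟩⟩
  · rintro ⟨φ, rfl⟩ 𝔭
    change pullbackPt _ ∈ σ '' V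
    rw [pullbackPt_imagePt]
    exact ⟨_, h.imagePt_mem (φ ≫ 𝔭), rfl⟩
  · intro hy
    replace hy : ∀ 𝔭, pullbackLift y 𝔭 ∈ σ '' V := fun 𝔭 => by
      rw [← pullbackPt_imagePt]
      exact hy 𝔭
    have hσy : ∀ 𝔭, imagePt ((pullbackFst X q).app B y) 𝔭 ∈ V ∧
        σ (imagePt ((pullbackFst X q).app B y) 𝔭) = pullbackLift y 𝔭 := fun 𝔭 => by
      obtain ⟨v, hv, e⟩ := hy 𝔭
      have hqv := apply_pullbackLift y 𝔭
      rw [← e, hσ.2 v hv] at hqv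
      rw [← hqv]
      exact ⟨hv, e⟩
    obtain ⟨φ, hφ⟩ := h.exists_hom (y := (pullbackFst X q).app B y) fun 𝔭 => (hσy 𝔭).1
    refine ⟨φ, pullback_ext hφ fun 𝔭 => ?_⟩
    rw [← (hσy 𝔭).2, ← hφ, imagePt_map]
    rfl

theorem mem_supported_sectionOpens {B : AdmAlg.{u}} {y : (pullback X q).obj B}
    (hy : pullbackLift y (closedPt B) ∈ σ '' V) :
    y ∈ (supported (pullback X q) (sectionOpens hσ cov)).obj B := by
  refine mem_supported_of_closedPt ?_
  change pullbackPt _ ∈ σ '' V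
  rwa [pullbackPt_imagePt]

end Chart

variable (hX : IsFormalScheme X) (cov : IsCoveringMap q)
include hX cov

theorem exists_chart_pullback {B : AdmAlg.{u}} (y : (pullback X q).obj B) :
    ∃ (A : AdmAlg.{u}) (a : X.obj A) (V : Opens (Pt X)), IsAffineChart a V ∧
      ∃ (σ : Pt X → P) (hσ : IsSectionOn q V σ),
        y ∈ (supported (pullback X q) (sectionOpens hσ cov)).obj B := by
  obtain ⟨A, a, V, h, hV⟩ := hX B ((pullbackFst X q).app B y)
  have hV0 := hV (closedPt B)
  rw [← apply_pullbackLift] at hV0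
  obtain ⟨σ, hσ, e⟩ := (h.isGood cov).exists_section _ hV0
  exact ⟨A, a, V, h, σ, hσ, mem_supported_sectionOpens hσ cov ⟨_, hV0, e⟩⟩

theorem isFormalScheme_pullback : IsFormalScheme (pullback X q) := by
  intro B y
  obtain ⟨A, a, V, h, σ, hσ, hy⟩ := exists_chart_pullback hX cov y
  exact ⟨A, _, _, isAffineChart_sectionLift h hσ cov, hy⟩

/-- On a chart the map is the open embedding into `X` followed by a section of the covering, and
sections have open images. -/
theorem isOpenMap_pullbackPt : IsOpenMap (pullbackPt (X := X) (q := q)) := by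
  intro O hO
  rw [isOpen_iff_mem_nhds]
  rintro _ ⟨y, hy, rfl⟩
  obtain ⟨A, a, V, h, σ, hσ, hyV⟩ := exists_chart_pullback hX cov (B := pt) y
  have hc := isAffineChart_sectionLift h hσ cov
  obtain ⟨𝔭, rfl⟩ := hc.exists_prime (x := y) (by
    have := hyV (𝟙 pt)
    rwa [imagePt_id] at this)
  have hD := h.isOpenEmbedding.isOpenMap _ (hO.preimage (continuous_imagePt
    (sectionLift hσ a h.mem_supported_self)))
  have hDV : imagePt a '' (imagePt (sectionLift hσ a h.mem_supported_self) ⁻¹' O) ⊆ V := by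
    rintro _ ⟨𝔮, -, rfl⟩
    exact h.imagePt_mem 𝔮
  refine mem_of_superset (((hσ.mono hDV).isOpen_image cov hD).mem_nhds ?_) ?_
  · rw [pullbackPt_imagePt]
    exact ⟨_, ⟨𝔭, hy, rfl⟩, rfl⟩
  · rintro _ ⟨_, ⟨𝔮, h𝔮, rfl⟩, rfl⟩
    exact ⟨_, h𝔮, by rw [pullbackPt_imagePt]; rfl⟩

/-- The underlying space of the fibre product is the covering. -/
noncomputable def pullbackHomeomorph : Pt (pullback X q) ≃ₜ P :=
  (Equiv.ofBijective _ bijective_pullbackPt).toHomeomorphOfContinuousOpen continuous_pullbackPt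
    (isOpenMap_pullbackPt hX cov)

/-- Over an affine `V` the copies are indexed by the fibre at `x`, through the sections of the
covering over `V`. -/
theorem isCoveringSpace_pullback (hq : Function.Surjective q) :
    IsCoveringSpace (pullbackFst X q) := by
  intro x
  obtain ⟨A, a, V, h, hx, -⟩ := hX.exists_chart (x := x) univ_mem
  have hG := h.isGood cov
  have hc := hG.isPathConnected.isConnected.isPreconnected
  have hs : ∀ e : q ⁻¹' {x}, ∃ σ, IsSectionOn q (V : Set (Pt X)) σ ∧ σ x = e := fun e => by
    obtain ⟨σ, hσ, e'⟩ := hG.exists_section e (by rw [e.2]; exact hx)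
    exact ⟨σ, hσ, by rw [← e', e.2]⟩
  choose σ hσ hσx using hs
  obtain ⟨e₀, he₀⟩ := hq x
  refine ⟨V, hx, q ⁻¹' {x}, ⟨⟨e₀, he₀⟩⟩, fun e =>
    { app := fun B => ↾fun y => sectionLift (hσ e) y.1 y.2
      naturality := fun B C φ => ?_ }, fun e => rfl, fun B y hy => ?_⟩
  · ext y
    refine pullback_ext rfl fun 𝔭 => ?_
    exact congrArg (σ e) (imagePt_map φ y.1 𝔭)
  · have hV0 := hy (closedPt B)
    rw [← apply_pullbackLift] at hV0
    -- The copy containing `y` is found at the closed point of `B`; uniqueness of lifts on the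
    -- connected spectrum extends the agreement to all of it.
    obtain ⟨τ, hτ, e⟩ := hG.exists_section _ hV0
    refine ⟨⟨τ x, hτ.2 x hx⟩, ?_, ?_⟩
    · have he := (hσ ⟨τ x, hτ.2 x hx⟩).eqOn cov hτ hc hx (hσx _)
      refine pullback_ext rfl fun 𝔭 => ?_
      refine congrFun (cov.eq_of_comp_eq (continuous_pullbackLift _) (continuous_pullbackLift _) ?_
        (closedPt B) ?_) 𝔭
      · funext 𝔮
        exact (apply_pullbackLift _ 𝔮).trans (apply_pullbackLift y 𝔮).symm
      · rw [← e, apply_pullbackLift (q := q)]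
        exact he (hy _)
    · intro i hi
      have hi' : σ i (imagePt ((pullbackFst X q).app B y) (closedPt B)) =
          pullbackLift y (closedPt B) := congrArg (fun z => pullbackLift z (closedPt B)) hi
      refine Subtype.ext ?_
      change i.1 = τ x
      rw [← hσx i]
      refine (hσ i).eqOn cov hτ hc (hy (closedPt B)) ?_ hx
      rw [hi', ← apply_pullbackLift, e]

/-- Any chart of the fibre product lies in one lifted from `X`, as a localisation of it, and the
same localisation is a chart of `X`. So integrality passes to the fibre product. -/
theorem exists_chart_of_chart_pullback {B : AdmAlg.{u}} {b : (pullback X q).obj B}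
    {W : Opens (Pt (pullback X q))} (h : IsAffineChart b W) :
    ∃ V : Opens (Pt X), IsAffineChart ((pullbackFst X q).app B b) V := by
  obtain ⟨A, a, V, ha, σ, hσ, hb⟩ := exists_chart_pullback hX cov b
  have hc := isAffineChart_sectionLift ha hσ cov
  obtain ⟨φ, rfl⟩ := hc.exists_hom hb
  obtain ⟨f, hf⟩ := hc.exists_isLoc h rfl
  exact ⟨_, ha.of_isLoc hf⟩

theorem isIntegral_pullback (hI : IsIntegral X) : IsIntegral (pullback X q) where
  cancel h := by
    obtain ⟨V, hV⟩ := exists_chart_of_chart_pullback hX cov h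
    exact hI.cancel hV
  nonboundary h h' φ e := by
    obtain ⟨V, hV⟩ := exists_chart_of_chart_pullback hX cov h
    obtain ⟨V', hV'⟩ := exists_chart_of_chart_pullback hX cov h'
    exact hI.nonboundary hV hV' φ (by rw [← e, pullbackFst_map])

end Pullback

end FOne

/-! ### Constancy of a trivialised character sheaf -/

namespace FOne

open Set Topology Filter

/-- A trivialisation of `K_X^×`: compatible injections of its groups of sections over affine open
subsets into a fixed set. -/
structure CharTriv {X : FPsh.{u}} (hI : IsIntegral X) (M : Type u) where
  toFun : ∀ W : AffineOpens X, FracGroup W.ring → M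
  injective : ∀ W, Function.Injective (toFun W)
  res : ∀ {V W : AffineOpens X} (h : V.1 ≤ W.1) (k : FracGroup W.ring),
    toFun V (fracRes hI h k) = toFun W k

section Constant

variable {X : FPsh.{u}} (hX : IsFormalScheme X)

include hX in
theorem exists_affineOpens {x : Pt X} {O : Set (Pt X)} (hO : O ∈ 𝓝 x) :
    ∃ W : AffineOpens X, x ∈ W.1 ∧ (W.1 : Set (Pt X)) ⊆ O := by
  obtain ⟨A, a, V, h, hx, hV⟩ := hX.exists_chart hO
  exact ⟨⟨V, A, a, h⟩, hx, hV⟩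

include hX in
/-- A function of affine open subsets that is invariant under restriction is constant on a
connected open subset. -/
theorem eq_of_isPreconnected {U : Opens (Pt X)} (hU : IsPreconnected (U : Set (Pt X))) {Z : Type*}
    (c : {W : AffineOpens X // W.1 ≤ U} → Z)
    (hc : ∀ V W : {W : AffineOpens X // W.1 ≤ U}, V.1.1 ≤ W.1.1 → c V = c W)
    (V W : {W : AffineOpens X // W.1 ≤ U}) : c V = c W := by
  have key : ∀ (V W : {W : AffineOpens X // W.1 ≤ U}) (x : Pt X), x ∈ V.1.1 → x ∈ W.1.1 →
      c V = c W := fun V W x hV hW => by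
    obtain ⟨T, hT, hTVW⟩ := exists_affineOpens hX ((V.1.1 ⊓ W.1.1).isOpen.mem_nhds ⟨hV, hW⟩)
    have hTV : T.1 ≤ V.1.1 := hTVW.trans inf_le_left
    have hTW : T.1 ≤ W.1.1 := hTVW.trans inf_le_right
    rw [← hc ⟨T, hTV.trans V.2⟩ V hTV, ← hc ⟨T, hTV.trans V.2⟩ W hTW]
  let P : Pt X → Pt X → Prop := fun x y => ∀ V W : {W : AffineOpens X // W.1 ≤ U},
    x ∈ V.1.1 → y ∈ W.1.1 → c V = c W
  have hP : ∀ x ∈ (U : Set (Pt X)), ∀ y ∈ (U : Set (Pt X)), P x y := by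
    intro x hx y hy
    refine hU.induction₂ P (fun x hx => ?_) (fun x y z _ hy _ hxy hyz => ?_)
      (fun x y _ _ h V W hV hW => (h W V hW hV).symm) hx hy
    · obtain ⟨T, hT, hTU⟩ := exists_affineOpens hX (U.isOpen.mem_nhds hx)
      filter_upwards [mem_nhdsWithin_of_mem_nhds (T.1.isOpen.mem_nhds hT)] with y hy V W hV hW
      exact (key V ⟨T, hTU⟩ x hV hT).trans (key ⟨T, hTU⟩ W y hy hW)
    · intro V W hV hW
      obtain ⟨T, hT, hTU⟩ := exists_affineOpens hX (U.isOpen.mem_nhds hy)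
      exact (hxy V ⟨T, hTU⟩ hV hT).trans (hyz ⟨T, hTU⟩ W hT hW)
  have hne : ∀ W : AffineOpens X, ∃ x, x ∈ W.1 := fun W =>
    ⟨_, W.isAffineChart.imagePt_mem (closedPt _)⟩
  obtain ⟨x, hx⟩ := hne V.1
  obtain ⟨y, hy⟩ := hne W.1
  exact hP x (V.2 hx) y (W.2 hy) V W hx hy

include hX in
-- For a section `s` the element `κ.toFun W (s W)` does not change under restriction, so it is the
-- same for all `W` in a connected open set. The ranges of the `κ.toFun W` also agree, since
-- restriction is surjective; hence a section over a small `V` extends uniquely.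
theorem CharTriv.isConstantOn {hI : IsIntegral X} {M : Type u} (κ : CharTriv hI M)
    {U : Opens (Pt X)} (hU : IsPreconnected (U : Set (Pt X))) :
    IsConstantOn (charSheaf hI) U := by
  intro x hx
  refine bijective_germ hx fun O hO => ?_
  obtain ⟨V, hxV, hVO⟩ := exists_affineOpens hX ((U ⊓ O).isOpen.mem_nhds ⟨hx, hO⟩)
  have hVU : V.1 ≤ U := hVO.trans inf_le_left
  refine ⟨V.1, hVU, hxV, hVO.trans inf_le_right, ?_⟩
  have hs : ∀ (s : charSections hI U) (W : {W : AffineOpens X // W.1 ≤ U}),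
      κ.toFun W.1 (s.1 W) = κ.toFun V (s.1 ⟨V, hVU⟩) := fun s W =>
    eq_of_isPreconnected hX hU (fun W => κ.toFun W.1 (s.1 W))
      (fun V W h => by rw [← s.2 V W h, κ.res]) W ⟨V, hVU⟩
  have hr : ∀ W : {W : AffineOpens X // W.1 ≤ U}, range (κ.toFun W.1) = range (κ.toFun V) :=
    fun W => eq_of_isPreconnected hX hU (fun W => range (κ.toFun W.1)) (fun V W h => by
      have hb : Function.Surjective (fracRes hI h) :=
        (bijective_chartFrac hI W.1.isAffineChart V.1.isAffineChart (AffineOpens.map_res h)).2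
      rw [← hb.range_comp]
      exact congrArg range (funext fun k => κ.res h k)) W ⟨V, hVU⟩
  constructor
  · intro s t hst
    have e : s.1 ⟨V, hVU⟩ = t.1 ⟨V, hVU⟩ :=
      congrArg (fun r : charSections hI V.1 => r.1 ⟨V, le_rfl⟩) hst
    refine Subtype.ext (funext fun W => κ.injective W.1 ?_)
    rw [hs s W, hs t W, e]
  · intro t
    have hex : ∀ W : {W : AffineOpens X // W.1 ≤ U}, ∃ k, κ.toFun W.1 k =
        κ.toFun V (t.1 ⟨V, le_rfl⟩) := fun W => by
      change _ ∈ range _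
      rw [hr W]
      exact mem_range_self _
    choose s hs' using hex
    refine ⟨⟨s, fun V' W h => κ.injective _ ?_⟩, ?_⟩
    · rw [κ.res, hs', hs']
    · refine Subtype.ext (funext fun W => κ.injective W.1 ?_)
      refine (hs' ⟨W.1, W.2.trans hVU⟩).trans ?_
      have ht := t.2 W ⟨V, le_rfl⟩ W.2
      exact ((congrArg _ ht).symm.trans (κ.res W.2 _)).symm

end Constant

end FOne

/-! ### Gluing the discrete spectra of the coordinate algebras -/

namespace FOne

open Set Topology Filter

/-- As the kernel is zero, `B` is the plain localisation of `A` as a monoid, so its universal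
property holds for homomorphisms that ignore the topology. -/
theorem IsLoc.exists_extend {A B : AdmAlg.{u}} {f : A} {φ : A ⟶ B} (h : IsLoc f φ)
    (hA : IsCancelMulZero A) (hφ : ∀ a, AdmAlg.ev φ a = 0 → a = 0) {C : Type*}
    [CommMonoidWithZero C] (χ : A →*₀ C) (hf : IsUnit (χ f)) :
    ∃ χ' : B →*₀ C, χ'.comp (AdmAlg.ev φ) = χ := by
  obtain ⟨w, hw⟩ := hf
  choose n a hna using h.surj
  have key : ∀ b m a', b * AdmAlg.ev φ f ^ m = AdmAlg.ev φ a' →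
      χ (a b) * ↑(w⁻¹ ^ n b) = χ a' * ↑(w⁻¹ ^ m) := by
    intro b m a' e
    have h1 : a b * f ^ m = a' * f ^ n b := by
      refine h.injective hA hφ ?_
      rw [map_mul, map_mul, map_pow, map_pow, ← hna, ← e, mul_right_comm]
    have h2 := congrArg χ h1
    rw [map_mul, map_mul, map_pow, map_pow, ← hw] at h2
    rw [inv_pow, inv_pow, Units.mul_inv_eq_iff_eq_mul, mul_right_comm, Units.eq_mul_inv_iff_mul_eq]
    exact_mod_cast h2
  refine ⟨⟨⟨fun b => χ (a b) * ↑(w⁻¹ ^ n b), ?_⟩, ?_, fun b c => ?_⟩, ?_⟩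
  · rw [key 0 0 0 (by simp)]
    simp
  · change χ (a 1) * ↑(w⁻¹ ^ n 1) = 1
    rw [key 1 0 1 (by simp)]
    simp
  · change χ (a (b * c)) * ↑(w⁻¹ ^ n (b * c)) = χ (a b) * ↑(w⁻¹ ^ n b) * (χ (a c) * ↑(w⁻¹ ^ n c))
    rw [key (b * c) (n b + n c) (a b * a c) (by
      rw [pow_add, mul_mul_mul_comm, hna, hna, map_mul]), map_mul, pow_add, Units.val_mul,
      mul_mul_mul_comm]
  · ext x
    change χ (a _) * ↑(w⁻¹ ^ n _) = χ x
    rw [key _ 0 x (by simp)]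
    simp

/-- The spectra of the coordinate algebras of the affine open subsets of `X`, without their
topology: homomorphisms from coordinate algebras to `B`. -/
abbrev PreAlg (X : FPsh.{u}) (B : Type u) [CommMonoidWithZero B] : Type u :=
  Σ U : AffineOpens X, U.ring →*₀ B

section Algebraisation

variable {X : FPsh.{u}} {B C : Type u} [CommMonoidWithZero B] [CommMonoidWithZero C]

/-- `x` is the restriction of `y` to a larger affine open subset. -/
def PreAlg.Res (x y : PreAlg X B) : Prop :=
  ∃ h : y.1.1 ≤ x.1.1, x.2 = y.2.comp (AdmAlg.ev (AffineOpens.res h))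

/-- Functoriality. -/
noncomputable def PreAlg.map (χ : B →*₀ C) (x : PreAlg X B) : PreAlg X C := ⟨x.1, χ.comp x.2⟩

theorem PreAlg.Res.map {x y : PreAlg X B} (h : x.Res y) (χ : B →*₀ C) :
    (x.map χ).Res (y.map χ) := by
  obtain ⟨h, e⟩ := h
  exact ⟨h, by unfold PreAlg.map; dsimp only; rw [e]; rfl⟩

variable (X) in
/-- The scheme glued from the spectra of the discrete coordinate algebras of the affine open subsets
of `X`. -/
noncomputable def algebraisation : FPsh.{u} where
  obj B := Quot (PreAlg.Res (X := X) (B := B))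
  map φ := ↾Quot.map (PreAlg.map (AdmAlg.ev φ)) fun _ _ h => h.map _
  map_id B := by
    refine ConcreteCategory.hom_ext _ _ ?_
    rintro ⟨x⟩
    rfl
  map_comp φ ψ := by
    refine ConcreteCategory.hom_ext _ _ ?_
    rintro ⟨x⟩
    rfl

/-- The class of a homomorphism from a coordinate algebra. -/
noncomputable def algMk {B : AdmAlg.{u}} (U : AffineOpens X) (φ : U.ring →*₀ B) :
    (algebraisation X).obj B :=
  Quot.mk _ ⟨U, φ⟩

theorem exists_algMk {B : AdmAlg.{u}} (y : (algebraisation X).obj B) : ∃ U φ, y = algMk U φ := by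
  obtain ⟨⟨U, φ⟩⟩ := y
  exact ⟨U, φ, rfl⟩

theorem imagePt_algMk {B : AdmAlg.{u}} (U : AffineOpens X) (φ : U.ring →*₀ B) (𝔭 : Prime B) :
    imagePt (algMk U φ) 𝔭 = algMk U ((AdmAlg.ev 𝔭).comp φ) := rfl

theorem algMk_res {B : AdmAlg.{u}} {U V : AffineOpens X} (h : V.1 ≤ U.1) (ψ : V.ring →*₀ B) :
    algMk U (ψ.comp (AdmAlg.ev (AffineOpens.res h))) = algMk V ψ :=
  Quot.sound ⟨h, rfl⟩

variable {hI : IsIntegral X} {M : Type u} (κ : CharTriv hI M)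

/-- The graph of the extension of a homomorphism to the fractions whose denominator it inverts. -/
def graph (x : PreAlg X B) : Set (M × B) :=
  {z | ∃ a s : nonZeroDivisors x.1.ring, IsUnit (x.2 s) ∧
    z.1 = κ.toFun x.1 (Algebra.GrothendieckGroup.of a / Algebra.GrothendieckGroup.of s) ∧
      z.2 * x.2 s = x.2 a}

theorem of_div_of_eq {A : AdmAlg.{u}} (hA : IsCancelMulZero A) {a s a' s' : nonZeroDivisors A}
    (h : Algebra.GrothendieckGroup.of a / Algebra.GrothendieckGroup.of s =
      Algebra.GrothendieckGroup.of a' / Algebra.GrothendieckGroup.of s') :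
    (a * s' : A) = a' * s := by
  have : IsCancelMul (nonZeroDivisors A) :=
    { mul_left_cancel := fun a b c e => Subtype.ext
        (mul_left_cancel₀ (nonZeroDivisors.coe_ne_zero a) (congrArg Subtype.val e))
      mul_right_cancel := fun a b c e => Subtype.ext
        (mul_right_cancel₀ (nonZeroDivisors.coe_ne_zero a) (congrArg Subtype.val e)) }
  rw [div_eq_div_iff_mul_eq_mul, ← map_mul, ← map_mul] at h
  exact congrArg Subtype.val (Algebra.GrothendieckGroup.of_injective h)

theorem graph_unique {x : PreAlg X B} {m : M} {b b' : B} (h : (m, b) ∈ graph κ x)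
    (h' : (m, b') ∈ graph κ x) : b = b' := by
  obtain ⟨a, s, hs, e, hb⟩ := h
  obtain ⟨a', s', hs', e', hb'⟩ := h'
  dsimp only at e e' hb hb'
  have := congrArg x.2
    (of_div_of_eq (hI.cancel x.1.isAffineChart) (κ.injective _ (e.symm.trans e')))
  rw [map_mul, map_mul, ← hb, ← hb'] at this
  refine (hs.mul hs').mul_right_cancel ?_
  rw [← mul_assoc, this, mul_assoc, mul_comm (x.2 s')]

theorem of_mem_graph (x : PreAlg X B) (a : nonZeroDivisors x.1.ring) :
    (κ.toFun x.1 (Algebra.GrothendieckGroup.of a), x.2 a) ∈ graph κ x :=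
  ⟨a, 1, by simp, by simp, by simp⟩

theorem exists_isLoc_res {U V : AffineOpens X} (h : V.1 ≤ U.1) :
    ∃ f, IsLoc f (AffineOpens.res h) :=
  U.isAffineChart.exists_isLoc V.isAffineChart (AffineOpens.map_res h)

theorem fracRes_of {U V : AffineOpens X} (h : V.1 ≤ U.1) (a : nonZeroDivisors U.ring) :
    fracRes hI h (Algebra.GrothendieckGroup.of a) =
      Algebra.GrothendieckGroup.of (nzRes hI h a) :=
  DFunLike.congr_fun (Algebra.GrothendieckGroup.lift.symm_apply_apply _) a

theorem coe_nzRes {U V : AffineOpens X} (h : V.1 ≤ U.1) (a : nonZeroDivisors U.ring) :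
    (nzRes hI h a : V.ring) = AdmAlg.ev (AffineOpens.res h) a := rfl

/-- Restriction to a smaller affine inverts one element, which the homomorphism sends to a unit; it
therefore yields the same fractions with invertible denominator and the same values. -/
theorem PreAlg.Res.graph_eq {x y : PreAlg X B} (h : x.Res y) : graph κ x = graph κ y := by
  obtain ⟨U, φ⟩ := x
  obtain ⟨V, ψ⟩ := y
  obtain ⟨(h : V.1 ≤ U.1), (rfl : φ = ψ.comp (AdmAlg.ev (AffineOpens.res h)))⟩ := h
  obtain ⟨f, hf⟩ := exists_isLoc_res h
  ext ⟨m, b⟩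
  constructor
  · rintro ⟨a, s, hs, rfl, hb⟩
    refine ⟨nzRes hI h a, nzRes hI h s, hs, ?_, hb⟩
    dsimp only
    rw [← fracRes_of, ← fracRes_of, ← map_div (fracRes hI h), κ.res]
  · rintro ⟨a, s, hs, rfl, hb⟩
    have := hI.cancel U.isAffineChart
    have := hI.cancel V.isAffineChart
    have hlift : ∀ a : nonZeroDivisors V.ring, ∃ (n : ℕ) (a' : nonZeroDivisors U.ring),
        (a : V.ring) * AdmAlg.ev (AffineOpens.res h) f ^ n = AdmAlg.ev (AffineOpens.res h) a' := by
      intro a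
      obtain ⟨n, a', e⟩ := hf.surj a
      refine ⟨n, ⟨a', mem_nonZeroDivisors_of_ne_zero ?_⟩, e⟩
      rintro rfl
      rw [map_zero] at e
      exact mul_ne_zero (nonZeroDivisors.coe_ne_zero a) (pow_ne_zero n hf.isUnit.ne_zero) e
    obtain ⟨n, a', ha⟩ := hlift a
    obtain ⟨k, s', hs'⟩ := hlift s
    let f' : nonZeroDivisors U.ring := ⟨f, mem_nonZeroDivisors_of_ne_zero (by
      rintro rfl
      exact hf.isUnit.ne_zero (map_zero _))⟩
    have hu := hf.isUnit.map ψ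
    -- The numerator needs `f ^ n` and the denominator `f ^ k` to come from the larger affine;
    -- multiplying crosswise gives both the factor `f ^ (n + k)`.
    have e1 : (nzRes hI h (a' * f' ^ k) : V.ring) =
        a * AdmAlg.ev (AffineOpens.res h) f ^ (n + k) := by
      rw [map_mul, Submonoid.coe_mul, coe_nzRes, ← ha, coe_nzRes, pow_add, ← mul_assoc]
      exact congrArg _ (map_pow (AdmAlg.ev (AffineOpens.res h)) f k)
    have e2 : (nzRes hI h (s' * f' ^ n) : V.ring) =
        s * AdmAlg.ev (AffineOpens.res h) f ^ (n + k) := by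
      rw [map_mul, Submonoid.coe_mul, coe_nzRes, ← hs', coe_nzRes, add_comm n, pow_add, ← mul_assoc]
      exact congrArg _ (map_pow (AdmAlg.ev (AffineOpens.res h)) f n)
    refine ⟨a' * f' ^ k, s' * f' ^ n, ?_, ?_, ?_⟩
    · change IsUnit (ψ (nzRes hI h (s' * f' ^ n)))
      rw [e2, map_mul, map_pow]
      exact hs.mul (hu.pow _)
    · dsimp only
      rw [← κ.res h, map_div, fracRes_of, fracRes_of]
      congr 1
      rw [div_eq_div_iff_mul_eq_mul, ← map_mul, ← map_mul]
      refine congrArg _ (Subtype.ext ?_)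
      rw [Submonoid.coe_mul, Submonoid.coe_mul, e1, e2, mul_assoc, mul_comm (_ ^ _)]
    · change b * ψ (nzRes hI h (s' * f' ^ n)) = ψ (nzRes hI h (a' * f' ^ k))
      rw [e1, e2, map_mul, map_mul, ← mul_assoc]
      exact congrArg (· * _) hb

theorem graph_eq_of_algMk_eq {B : AdmAlg.{u}} {U V : AffineOpens X} {φ : U.ring →*₀ B}
    {ψ : V.ring →*₀ B} (h : algMk U φ = algMk V ψ) : graph κ ⟨U, φ⟩ = graph κ ⟨V, ψ⟩ :=
  congrArg (Quot.lift (graph κ) fun _ _ h => h.graph_eq κ) h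

include κ in
-- This excludes that a chain of gluings identifies a chart with itself nontrivially: the graph is
-- invariant under gluing, single-valued, and recovers the homomorphism.
theorem algMk_injective {B : AdmAlg.{u}} {U : AffineOpens X} {φ ψ : U.ring →*₀ B}
    (h : algMk U φ = algMk U ψ) : φ = ψ := by
  have := hI.cancel U.isAffineChart
  ext a
  by_cases ha : a = 0
  · rw [ha, map_zero, map_zero]
  · have h1 := of_mem_graph κ ⟨U, φ⟩ ⟨a, mem_nonZeroDivisors_of_ne_zero ha⟩
    rw [graph_eq_of_algMk_eq κ h] at h1
    exact graph_unique κ h1 (of_mem_graph κ ⟨U, ψ⟩ ⟨a, mem_nonZeroDivisors_of_ne_zero ha⟩)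

/-- Near `x`, the chart of `x` is contained in the chart of `y`. -/
def Near {B : AdmAlg.{u}} (x y : PreAlg X B) : Prop :=
  graph κ x = graph κ y ∧ ∃ g : x.1.ring, IsUnit (x.2 g) ∧ ∀ (B' : AdmAlg.{u}) (φ : x.1.ring →*₀ B'),
    IsUnit (φ g) → ∃ ψ : y.1.ring →*₀ B', algMk x.1 φ = algMk y.1 ψ

/-- The element `k` that guards the passage from `y` to `z` must be read in the chart of `x`.
Equality of graphs writes it there as a fraction `a / s`. -/
theorem Near.trans {B : AdmAlg.{u}} {x y z : PreAlg X B} (h : Near κ x y) (h' : Near κ y z) :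
    Near κ x z := by
  obtain ⟨e, g, hg, hgy⟩ := h
  obtain ⟨e', k, hk, hkz⟩ := h'
  have := hI.cancel x.1.isAffineChart
  have := hI.cancel y.1.isAffineChart
  let k' : nonZeroDivisors y.1.ring := ⟨k, mem_nonZeroDivisors_of_ne_zero (by
    rintro rfl
    exact hk.ne_zero (map_zero _))⟩
  have hm := of_mem_graph κ y k'
  rw [← e] at hm
  obtain ⟨a, s, hs, em, eb⟩ := hm
  dsimp only at em eb
  -- Inverting `g` moves to the chart of `y`; inverting `s` and `a` makes `k = a / s` defined and
  -- invertible.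
  refine ⟨e.trans e', g * s * a, ?_, fun B' φ hφ => ?_⟩
  · rw [map_mul, map_mul, ← eb]
    exact (hg.mul hs).mul (hk.mul hs)
  · rw [map_mul, map_mul, IsUnit.mul_iff, IsUnit.mul_iff] at hφ
    obtain ⟨⟨hg', hs'⟩, ha'⟩ := hφ
    obtain ⟨ψ, hψ⟩ := hgy B' φ hg'
    obtain ⟨w, hw⟩ := hs'
    have h1 : (κ.toFun y.1 (Algebra.GrothendieckGroup.of k'), φ a * ↑w⁻¹) ∈
        graph κ (⟨x.1, φ⟩ : PreAlg X B') :=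
      ⟨a, s, ⟨w, hw⟩, em, by dsimp only; rw [← hw, mul_assoc, Units.inv_mul, mul_one]⟩
    rw [graph_eq_of_algMk_eq κ hψ] at h1
    have h2 := graph_unique κ h1 (of_mem_graph κ ⟨y.1, ψ⟩ k')
    obtain ⟨χ, hχ⟩ := hkz B' ψ (by
      change IsUnit (ψ k')
      rw [← h2]
      exact ha'.mul (Units.isUnit _))
    exact ⟨χ, hψ.trans hχ⟩

theorem PreAlg.Res.near {B : AdmAlg.{u}} {x y : PreAlg X B} (h : x.Res y) :
    Near κ x y ∧ Near κ y x := by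
  refine ⟨⟨h.graph_eq κ, ?_⟩, ⟨(h.graph_eq κ).symm, 1, by simp, fun B' ψ _ => ?_⟩⟩
  · obtain ⟨U, φ⟩ := x
    obtain ⟨V, ψ⟩ := y
    obtain ⟨(h : V.1 ≤ U.1), (rfl : φ = ψ.comp (AdmAlg.ev (AffineOpens.res h)))⟩ := h
    obtain ⟨f, hf⟩ := exists_isLoc_res h
    refine ⟨f, hf.isUnit.map ψ, fun B' φ hφ => ?_⟩
    obtain ⟨χ, rfl⟩ := hf.exists_extend (hI.cancel U.isAffineChart)
      (hI.nonboundary U.isAffineChart V.isAffineChart _ (AffineOpens.map_res h)) φ hφ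
    exact ⟨χ, algMk_res h χ⟩
  · exact ⟨_, (algMk_res h.choose ψ).symm⟩

/-- Equality in the quotient is a zigzag of restrictions. `Near` is not visibly symmetric, so both
directions are carried through the induction. -/
theorem near_of_algMk_eq {B : AdmAlg.{u}} {U V : AffineOpens X} {φ : U.ring →*₀ B}
    {ψ : V.ring →*₀ B} (h : algMk U φ = algMk V ψ) : Near κ ⟨U, φ⟩ ⟨V, ψ⟩ := by
  have key : ∀ x y : PreAlg X B, Relation.EqvGen PreAlg.Res x y → Near κ x y ∧ Near κ y x := by
    intro x y h
    induction h with
    | rel x y h => exact h.near κ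
    | refl x => exact ⟨⟨rfl, 1, by simp, fun B' φ _ => ⟨φ, rfl⟩⟩, rfl, 1, by simp,
        fun B' φ _ => ⟨φ, rfl⟩⟩
    | symm x y _ h => exact h.symm
    | trans x y z _ _ h h' => exact ⟨h.1.trans κ h'.1, h'.2.trans κ h.2⟩
  exact (key _ _ (Quot.eqvGen_exact h)).1

include κ in
theorem isOpen_algChart (U : AffineOpens X) :
    IsOpen {z : Pt (algebraisation X) | ∃ φ, z = algMk U φ} := by
  rw [isOpen_iff]
  intro B y
  obtain ⟨W, φ, rfl⟩ := exists_algMk y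
  rw [isOpen_iff_mem_nhds]
  rintro 𝔭 ⟨ψ, e⟩
  rw [imagePt_algMk] at e
  obtain ⟨-, g, hg, hgU⟩ := near_of_algMk_eq κ e
  exact mem_of_superset ((isOpen_basicOpen (φ g)).mem_nhds hg.ne_zero) fun 𝔮 h𝔮 =>
    hgU pt _ (isUnit_pt h𝔮)

/-- The affine chart of the algebraisation given by an affine open subset. -/
noncomputable def algChart (U : AffineOpens X) : (algebraisation X).obj (.disc U.ring) :=
  algMk U (MonoidWithZeroHom.id _)

/-- A homomorphism out of a discrete algebra. -/
def discHom {R : Type u} [CommMonoidWithZero R] [Nontrivial R] {B : AdmAlg.{u}} (φ : R →*₀ B) :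
    AdmAlg.disc R ⟶ B := ⟨φ, fun _ hI => (AdmAlg.isIdeal hI).preimage φ⟩

/-- If the closed point of `Spec B` lies in the chart, the element `g` provided by `Near` is a unit
at that point, hence a unit of `B`, and the whole of `Spec B` lies in the chart. -/
theorem isAffineChart_algChart (U : AffineOpens X) :
    IsAffineChart (algChart U) ⟨_, isOpen_algChart κ U⟩ := by
  refine ⟨fun B φ ψ h => ?_, fun B y => ⟨?_, fun hy => ?_⟩⟩
  · exact hom_ext fun a => DFunLike.congr_fun (algMk_injective κ h) a
  · rintro ⟨φ, rfl⟩ 𝔭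
    exact ⟨_, rfl⟩
  · obtain ⟨W, φ, rfl⟩ := exists_algMk y
    obtain ⟨ψ, e⟩ := hy (closedPt B)
    rw [imagePt_algMk] at e
    obtain ⟨-, g, hg, hgU⟩ := near_of_algMk_eq κ e
    obtain ⟨χ, hχ⟩ := hgU B φ (ev_closedPt_ne_zero.1 hg.ne_zero)
    exact ⟨discHom χ, hχ.symm⟩

include κ in
theorem isScheme_algebraisation : IsScheme (algebraisation X) := by
  intro B y
  obtain ⟨U, φ, rfl⟩ := exists_algMk y
  refine ⟨_, _, _, ?_, isAffineChart_algChart κ U, fun 𝔭 => ⟨_, rfl⟩⟩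
  exact ⟨rfl, by rintro b x (rfl : x = 0); exact mul_zero b⟩

end Algebraisation

end FOne

/-! ### A formal scheme as the completion of its algebraisation -/

namespace FOne

open Set Topology Filter

theorem exists_forall_prod_mem {M : Type*} [CommMonoid M] {J : Set M}
    (hJ : ∀ a x, x ∈ J → a * x ∈ J) (S : Finset M) (h : ∀ s ∈ S, ∃ n : ℕ, s ^ n ∈ J) :
    ∃ N : ℕ, ∀ s : Fin N → M, (∀ i, s i ∈ S) → ∏ i, s i ∈ J := by
  classical
  choose! n hn using h
  -- By the pigeonhole principle, among this many factors some `t` occurs more than `∑ n s ≥ n t`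
  -- times.
  refine ⟨S.card * (∑ s ∈ S, n s) + 1, fun s hs => ?_⟩
  obtain ⟨t, ht, hcard⟩ := Finset.exists_lt_card_fiber_of_mul_lt_card_of_maps_to
    (s := Finset.univ) (t := S) (f := s) (n := ∑ s ∈ S, n s) (fun i _ => hs i) (by simp)
  rw [← Finset.prod_filter_mul_prod_filter_not Finset.univ (fun i => s i = t), mul_comm,
    Finset.prod_congr rfl (g := fun _ => t) (fun i hi => (Finset.mem_filter.1 hi).2),
    Finset.prod_const]
  refine hJ _ _ ?_
  obtain ⟨k, hk⟩ := exists_add_of_le ((Finset.single_le_sum (f := n) (by simp) ht).trans hcard.le)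
  rw [hk, pow_add, mul_comm]
  exact hJ _ _ (hn t ht)

/-- A homomorphism is continuous if its composites with all open primes are. -/
theorem exists_ev_eq {A B : AdmAlg.{u}} (φ : A →*₀ B)
    (h : ∀ 𝔭 : Prime B, ∀ s ∈ A.gens, AdmAlg.ev 𝔭 (φ s) = 0) : ∃ φ' : A ⟶ B, AdmAlg.ev φ' = φ := by
  refine ⟨⟨φ, fun I hI => AdmAlg.mem_openIdeals.2 ⟨(AdmAlg.isIdeal hI).preimage φ, ?_⟩⟩, rfl⟩
  refine exists_forall_prod_mem ((AdmAlg.isIdeal hI).preimage φ).2 _ fun s hs => ?_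
  obtain ⟨n, hn⟩ := exists_pow_mem_of_forall_prime (fun 𝔭 => h 𝔭 s hs) hI
  exact ⟨n, by simpa using hn⟩

theorem ev_injective {A B : AdmAlg.{u}} {φ ψ : A ⟶ B} (h : AdmAlg.ev φ = AdmAlg.ev ψ) : φ = ψ :=
  hom_ext fun a => DFunLike.congr_fun h a

section Completion

variable {X : FPsh.{u}}

/-- The points of `X` given by the continuous homomorphism `y`, if it is continuous. -/
def contPoints {B : AdmAlg.{u}} (y : PreAlg X B) : Set (X.obj B) :=
  {x | ∃ φ : y.1.ring ⟶ B, AdmAlg.ev φ = y.2 ∧ X.map φ y.1.incl = x}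

/-- The localisation carries the induced topology, so a homomorphism out of it is continuous as soon
as its restriction is. -/
theorem PreAlg.Res.contPoints_eq {B : AdmAlg.{u}} {x y : PreAlg X B} (h : x.Res y) :
    contPoints x = contPoints y := by
  obtain ⟨U, φ⟩ := x
  obtain ⟨V, ψ⟩ := y
  obtain ⟨(h : V.1 ≤ U.1), (rfl : φ = ψ.comp (AdmAlg.ev (AffineOpens.res h)))⟩ := h
  ext x
  constructor
  · rintro ⟨φ, e, rfl⟩
    obtain ⟨f, hf⟩ := exists_isLoc_res h
    let χ : V.ring ⟶ B := ⟨ψ, hf.continuous_of_comp ψ fun I hI => by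
      rw [← show AdmAlg.ev φ = ψ.comp (AdmAlg.ev (AffineOpens.res h)) from e]
      exact ev_mem φ hI⟩
    refine ⟨χ, rfl, ?_⟩
    dsimp only
    rw [← AffineOpens.map_res h, ← X.map_comp_apply]
    exact congrArg (fun φ => X.map φ U.incl) (ev_injective e.symm)
  · rintro ⟨(χ : V.ring ⟶ B), (rfl : AdmAlg.ev χ = ψ), rfl⟩
    refine ⟨AffineOpens.res h ≫ χ, rfl, ?_⟩
    dsimp only
    rw [X.map_comp_apply, AffineOpens.map_res]

/-- The points of `X` that map to a given point of the algebraisation. -/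
def algPoints {B : AdmAlg.{u}} (y : (algebraisation X).obj B) : Set (X.obj B) :=
  Quot.lift contPoints (fun _ _ h => h.contPoints_eq) y

theorem mem_algPoints {B : AdmAlg.{u}} {U : AffineOpens X} {φ : U.ring →*₀ B} {x : X.obj B} :
    x ∈ algPoints (algMk U φ) ↔ ∃ φ' : U.ring ⟶ B, AdmAlg.ev φ' = φ ∧ X.map φ' U.incl = x := Iff.rfl

variable (X) in
/-- The points of `X`, as a subset of the algebraisation. -/
def algMarking : Set (Pt (algebraisation X)) := {z | (algPoints (B := pt) z).Nonempty}

theorem algMk_mem_algMarking {U : AffineOpens X} {φ : U.ring →*₀ pt.{u}} :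
    (algMk U φ : Pt (algebraisation X)) ∈ algMarking X ↔ ∀ s ∈ U.ring.gens, φ s = 0 := by
  constructor
  · rintro ⟨x, (𝔭 : Prime U.ring), (rfl : AdmAlg.ev 𝔭 = φ), -⟩ s hs
    exact ev_gens 𝔭 hs
  · intro h
    exact ⟨_, mkPrime φ h, rfl, rfl⟩

variable (X) in
theorem isMarking_algMarking : IsMarking (algebraisation X) (algMarking X) := by
  classical
  intro B y
  obtain ⟨U, φ, rfl⟩ := exists_algMk y
  refine ⟨U.ring.gens.image φ, fun 𝔭 => ?_⟩
  rw [Finset.forall_mem_image]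
  exact algMk_mem_algMarking (φ := (AdmAlg.ev 𝔭).comp φ)

/-- Both sides say that the homomorphism is continuous: by `exists_ev_eq` this can be tested at the
points of `Spec B`. -/
theorem nonempty_algPoints_iff {B : AdmAlg.{u}} {y : (algebraisation X).obj B} :
    (algPoints y).Nonempty ↔ y ∈ (supported _ (algMarking X)).obj B := by
  obtain ⟨U, φ, rfl⟩ := exists_algMk y
  constructor
  · rintro ⟨x, (φ' : U.ring ⟶ B), (rfl : AdmAlg.ev φ' = φ), -⟩ 𝔭
    exact ⟨_, φ' ≫ 𝔭, rfl, rfl⟩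
  · intro h
    obtain ⟨φ, rfl⟩ := exists_ev_eq φ fun 𝔭 s hs => algMk_mem_algMarking.1 (h 𝔭) s hs
    exact ⟨_, φ, rfl, rfl⟩

theorem subsingleton_algPoints {B : AdmAlg.{u}} (y : (algebraisation X).obj B) :
    (algPoints y).Subsingleton := by
  obtain ⟨U, φ, rfl⟩ := exists_algMk y
  rintro x ⟨(χ : U.ring ⟶ B), (rfl : AdmAlg.ev χ = φ), rfl⟩ x' ⟨φ', e, rfl⟩
  exact congrArg (fun φ => X.map φ U.incl) (ev_injective e.symm)

variable (hX : IsFormalScheme X)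

include hX in
theorem exists_mem_algPoints {B : AdmAlg.{u}} (x : X.obj B) : ∃ y, x ∈ algPoints y := by
  obtain ⟨A, a, V, h, hx⟩ := hX B x
  let U : AffineOpens X := ⟨V, A, a, h⟩
  obtain ⟨φ, rfl⟩ := (U.isAffineChart.2 B x).2 hx
  exact ⟨algMk U (AdmAlg.ev φ), φ, rfl, rfl⟩

include hX in
-- Two affine opens through which `Spec B` factors share an affine neighbourhood of the image of the
-- closed point. That neighbourhood contains the whole image, and both classes restrict to it.
theorem eq_of_mem_algPoints {B : AdmAlg.{u}} {x : X.obj B} {y y' : (algebraisation X).obj B}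
    (h : x ∈ algPoints y) (h' : x ∈ algPoints y') : y = y' := by
  obtain ⟨U, φ, rfl⟩ := exists_algMk y
  obtain ⟨U', φ', rfl⟩ := exists_algMk y'
  obtain ⟨(φ : U.ring ⟶ B), rfl, rfl⟩ := mem_algPoints.1 h
  obtain ⟨(φ' : U'.ring ⟶ B), rfl, e⟩ := mem_algPoints.1 h'
  have hU := (U.isAffineChart.2 B _).1 ⟨φ, rfl⟩
  have hU' := (U'.isAffineChart.2 B _).1 ⟨φ', rfl⟩
  rw [e] at hU'
  obtain ⟨V, hV, hVU⟩ := exists_affineOpens hX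
    ((U.1 ⊓ U'.1).isOpen.mem_nhds ⟨hU (closedPt B), hU' (closedPt B)⟩)
  have hVU1 : V.1 ≤ U.1 := hVU.trans inf_le_left
  have hVU2 : V.1 ≤ U'.1 := hVU.trans inf_le_right
  obtain ⟨ψ, hψ⟩ := (V.isAffineChart.2 B (X.map φ U.incl)).2 (mem_supported_of_closedPt hV)
  have key : ∀ (W : AffineOpens X) (h : V.1 ≤ W.1) (χ : W.ring ⟶ B),
      X.map χ W.incl = X.map φ U.incl → algMk W (AdmAlg.ev χ) = algMk V (AdmAlg.ev ψ) := by
    intro W h χ hχ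
    rw [← algMk_res h]
    have : χ = AffineOpens.res h ≫ ψ := W.isAffineChart.1 B (by
      dsimp only
      rw [X.map_comp_apply, AffineOpens.map_res, hψ, hχ])
    rw [this]
    rfl
  rw [key U hVU1 φ rfl, key U' hVU2 φ' e]

theorem map_mem_algPoints {B C : AdmAlg.{u}} (χ : B ⟶ C) {x : X.obj B}
    {y : (algebraisation X).obj B} (h : x ∈ algPoints y) :
    X.map χ x ∈ algPoints ((algebraisation X).map χ y) := by
  obtain ⟨U, φ, rfl⟩ := exists_algMk y
  obtain ⟨φ, rfl, rfl⟩ := mem_algPoints.1 h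
  exact ⟨φ ≫ χ, rfl, X.map_comp_apply _ _ _⟩

/-- A formal scheme is the completion of its algebraisation. -/
noncomputable def completionIso : X ≅ completion (algebraisation X) (algMarking X) :=
  NatIso.ofComponents (fun B => Equiv.toIso (Equiv.ofBijective
    (fun x => ⟨(exists_mem_algPoints hX x).choose,
      nonempty_algPoints_iff.1 ⟨x, (exists_mem_algPoints hX x).choose_spec⟩⟩)
    ⟨fun x x' e => subsingleton_algPoints _ (exists_mem_algPoints hX x).choose_spec (by
        rw [show (exists_mem_algPoints hX x).choose = (exists_mem_algPoints hX x').choose from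
          Subtype.mk.inj e]
        exact (exists_mem_algPoints hX x').choose_spec),
      fun ⟨y, hy⟩ => by
        obtain ⟨x, hx⟩ := nonempty_algPoints_iff.2 hy
        exact ⟨x, Subtype.ext (eq_of_mem_algPoints hX
          (exists_mem_algPoints hX x).choose_spec hx)⟩⟩)) fun {B C} χ => by
    refine ConcreteCategory.hom_ext _ _ fun x => Subtype.ext ?_
    exact eq_of_mem_algPoints hX (exists_mem_algPoints hX _).choose_spec
      (map_mem_algPoints χ (exists_mem_algPoints hX x).choose_spec)

include hX in
/-- An integral formal scheme whose sheaf of characters has a trivialisation is algebraisable. -/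
theorem CharTriv.isAlgebraisable {hI : IsIntegral X} {M : Type u} (κ : CharTriv hI M) :
    IsAlgebraisable X :=
  ⟨_, _, isScheme_algebraisation κ, isMarking_algMarking X, ⟨completionIso hX⟩⟩

end Completion

end FOne

/-! ### The covering space that trivialises `K_X^×` -/

namespace FOne

open Set Topology Filter

section Homeo

variable {T E P : Type u} [TopologicalSpace T] [TopologicalSpace E] [TopologicalSpace P] {p : E → T}
  {cov : IsCoveringMap p} (hG : ∀ x : T, ∀ O ∈ 𝓝 x, ∃ U ⊆ O, x ∈ U ∧ IsGood p U)
  (h : P ≃ₜ TrivCover cov) (r : C(P, T)) (e : ∀ y, r y = (h y).pt)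
include hG h e

theorem TrivCover.bijective_connectedComponentsMap_of_homeomorph :
    Function.Bijective r.continuous.connectedComponentsMap := by
  obtain rfl : r = (⟨pt, continuous_pt hG⟩ : C(TrivCover cov, T)).comp ⟨h, h.continuous⟩ :=
    ContinuousMap.ext e
  have hh : Function.Bijective h.continuous.connectedComponentsMap := by
    refine Function.bijective_iff_has_inverse.2 ⟨h.symm.continuous.connectedComponentsMap, ?_, ?_⟩
    · exact ConnectedComponents.surjective_coe.forall.2 fun x =>
        congrArg _ (h.symm_apply_apply x)
    · exact ConnectedComponents.surjective_coe.forall.2 fun x =>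
        congrArg _ (h.apply_symm_apply x)
  convert! (bijective_connectedComponentsMap hG).comp hh using 1
  exact ConnectedComponents.surjective_coe.injective_comp_right rfl

theorem TrivCover.range_map_of_homeomorph (y : P) :
    (FundamentalGroup.map r y).range = (cov.monodromyPerm (r y)).ker := by
  obtain rfl : r = (⟨pt, continuous_pt hG⟩ : C(TrivCover cov, T)).comp ⟨h, h.continuous⟩ :=
    ContinuousMap.ext e
  refine Eq.trans ?_ (range_map hG (h y))
  ext γ
  constructor
  · rintro ⟨δ, rfl⟩
    refine ⟨FundamentalGroup.map (⟨h, h.continuous⟩ : C(P, TrivCover cov)) y δ, ?_⟩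
    obtain ⟨δ⟩ := δ
    rfl
  · rintro ⟨δ, rfl⟩
    obtain ⟨δ⟩ := δ
    refine ⟨.mk ((δ.map h.symm.continuous).cast (h.symm_apply_apply y).symm
      (h.symm_apply_apply y).symm), ?_⟩
    change Path.Homotopic.Quotient.mk _ = Path.Homotopic.Quotient.mk _
    congr 1
    ext t
    change (h (h.symm (δ t))).pt = (δ t).pt
    rw [h.apply_symm_apply]

end Homeo

section CharacterCover

variable {X : FPsh.{u}} (hI : IsIntegral X) (hX : IsFormalScheme X)

include hX in
/-- The étalé space of `K_X^×` is a covering. -/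
theorem isCoveringMap_charSheaf :
    IsCoveringMap (TopCat.Presheaf.EtaleSpace.base (F := charSheaf hI)) :=
  TopCat.Presheaf.EtaleSpace.isCoveringMap_base (isLocalSystem_charSheaf hI hX)

/-- The covering space that trivialises the sheaf `K_X^×`. -/
noncomputable abbrev charCover : FPsh.{u} :=
  pullback X (TrivCover.pt (cov := isCoveringMap_charSheaf hI hX))

/-- The covering map of the covering space that trivialises the sheaf `K_X^×`. -/
noncomputable abbrev charCoverMap : charCover hI hX ⟶ X :=
  pullbackFst X (TrivCover.pt (cov := isCoveringMap_charSheaf hI hX))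

theorem isCoveringMap_charCover :
    IsCoveringMap (TrivCover.pt (cov := isCoveringMap_charSheaf hI hX)) :=
  TrivCover.isCoveringMap_pt (hX.exists_isGood (isCoveringMap_charSheaf hI hX))

theorem isIntegral_charCover : IsIntegral (charCover hI hX) :=
  isIntegral_pullback hX (isCoveringMap_charCover hI hX) hI

variable {hI hX} {B C : AdmAlg.{u}} {b : (charCover hI hX).obj B} {c : (charCover hI hX).obj C}
  {V W : Opens (Pt X)} (hb : IsAffineChart ((charCoverMap hI hX).app B b) V)
  (hc : IsAffineChart ((charCoverMap hI hX).app C c) W)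

/-- The trivialisation of `K_X^×` over a chart of the trivialising covering space. -/
noncomputable def charTrivAt (m : Prime B) (k : FracGroup B) : (charSheaf hI).EtaleSpace :=
  (pullbackLift b m).toFun ⟨⟨imagePt ((charCoverMap hI hX).app B b) m,
    chartGerm hI hb (hb.imagePt_mem m) k⟩, (apply_pullbackLift b m).symm⟩

/-- The germs of one section and the lift to the holonomy covering form a compatible pair over the
connected spectrum of `B`, so the value is constant. -/
theorem charTrivAt_eq (m m' : Prime B) (k : FracGroup B) :
    charTrivAt hb m k = charTrivAt hb m' k := by
  unfold charTrivAt
  exact (TrivCover.isLocallyConstant_toFun (hX.exists_isGood (isCoveringMap_charSheaf hI hX))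
    (continuous_pullbackLift b)
    (continuous_etaleSpace_germ (continuous_imagePt ((charCoverMap hI hX).app B b)) hb.imagePt_mem
      (chartSection hI hb k)) _).apply_eq_of_preconnectedSpace m m'

theorem injective_charTrivAt (m : Prime B) : Function.Injective (charTrivAt hb m) := by
  intro k l h
  have := congrArg Subtype.val ((pullbackLift b m).injective h)
  exact (bijective_chartGerm hI hb hX (hb.imagePt_mem m)).1
    (eq_of_heq (TopCat.Presheaf.EtaleSpace.mk.inj this).2)

theorem charTrivAt_chartFrac {φ : B ⟶ C} (h : (charCover hI hX).map φ b = c)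
    (e : X.map φ ((charCoverMap hI hX).app B b) = (charCoverMap hI hX).app C c) (m : Prime C)
    (k : FracGroup B) :
    charTrivAt hc m (chartFrac hI hb hc φ e k) = charTrivAt hb (φ ≫ m) k := by
  subst h
  refine TrivCover.toFun_congr rfl ?_
  have hV : W ≤ V := fun x hx => by
    obtain ⟨𝔭, rfl⟩ := hc.exists_prime hx
    rw [← e, imagePt_map]
    exact hb.imagePt_mem _
  have key : ∀ (x : Pt X) (h1 : imagePt ((charCoverMap hI hX).app B b) (φ ≫ m) = x) (hx : x ∈ W),
      (⟨x, chartGerm hI hc hx (chartFrac hI hb hc φ e k)⟩ : (charSheaf hI).EtaleSpace) =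
        ⟨_, chartGerm hI hb (hb.imagePt_mem (φ ≫ m)) k⟩ := by
    rintro x rfl hx
    rw [chartGerm_chartFrac hI hb hc hV]
  exact key _ (by rw [← e, imagePt_map]) _

variable (hI hX) in
/-- The trivialisation of the character sheaf of the trivialising covering space. -/
noncomputable def charTriv : CharTriv (isIntegral_charCover hI hX) (charSheaf hI).EtaleSpace where
  toFun W := charTrivAt (exists_chart_of_chart_pullback hX (isCoveringMap_charCover hI hX)
    W.isAffineChart).choose_spec (closedPt _)
  injective W := injective_charTrivAt _ _
  res {V W} h k := by
    -- The closed point of the smaller affine need not map to that of the larger one; independence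
    -- of the evaluation point absorbs the difference.
    refine Eq.trans ?_ (charTrivAt_eq _ (AffineOpens.res h ≫ closedPt _) _ k)
    exact charTrivAt_chartFrac _ _ (AffineOpens.map_res h)
      ((NatTrans.naturality_apply (charCoverMap hI hX) (AffineOpens.res h) W.incl).symm.trans
        (congrArg _ (AffineOpens.map_res h))) _ k

end CharacterCover

theorem IsFormalScheme.locallyPathConnectedSpace {X : FPsh.{u}} (hX : IsFormalScheme X)
    (hI : IsIntegral X) : LocallyPathConnectedSpace (Pt X) :=
  TrivCover.locallyPathConnectedSpace (hX.exists_isGood (isCoveringMap_charSheaf hI hX))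

end FOne

theorem mainTheorem12 (X : FOne.FPsh.{u}) (hX : FOne.IsFormalScheme X) (hI : FOne.IsIntegral X) :
    ∃ (hK : FOne.IsLocalSystem (FOne.charSheaf hI))
      (ρ : ∀ x : FOne.space X,
        FundamentalGroup (FOne.space X) x →* MulAut ((FOne.charSheaf hI).stalk x)),
      (∀ x, FOne.IsMonodromyAction hK x (ρ x)) ∧
      ∃ (Y : FOne.FPsh.{u}) (π : Y ⟶ X),
        FOne.IsFormalScheme Y ∧ FOne.IsCoveringSpace π ∧ FOne.IsAlgebraisable Y ∧
        Function.Bijective (FOne.mapPt π).continuous.connectedComponentsMap ∧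
        (∀ y : FOne.space Y,
          (FundamentalGroup.map (FOne.mapPt π) y).range = (ρ (FOne.mapPt π y)).ker) ∧
        ∃ hY : FOne.IsIntegral Y, ∀ y : FOne.space Y, ∃ U : Opens (FOne.space Y),
          (U : Set (FOne.space Y)) = connectedComponent y ∧
            FOne.IsConstantOn (FOne.charSheaf hY) U := by
  have hG := hX.exists_isGood (FOne.isCoveringMap_charSheaf hI hX)
  have cov := FOne.isCoveringMap_charCover hI hX
  have hY := FOne.isFormalScheme_pullback hX cov
  have hIY := FOne.isIntegral_charCover hI hX
  have e : ∀ y, FOne.mapPt (FOne.charCoverMap hI hX) y = (FOne.pullbackHomeomorph hX cov y).pt :=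
    fun y => (FOne.apply_pullbackPt y).symm
  refine ⟨FOne.isLocalSystem_charSheaf hI hX, FOne.monodromyHom _,
    FOne.isMonodromyAction_monodromyHom _, FOne.charCover hI hX, FOne.charCoverMap hI hX, hY,
    FOne.isCoveringSpace_pullback hX cov FOne.TrivCover.surjective_pt,
    (FOne.charTriv hI hX).isAlgebraisable hY,
    FOne.TrivCover.bijective_connectedComponentsMap_of_homeomorph hG _ _ e,
    fun y => ?_, hIY, fun y => ?_⟩
  · rw [FOne.ker_monodromyHom]
    exact FOne.TrivCover.range_map_of_homeomorph hG _ _ e y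
  -- Components are open because path connected affine opens form a basis.
  · have := hY.locallyPathConnectedSpace hIY
    exact ⟨⟨connectedComponent y, isOpen_connectedComponent⟩, rfl,
      (FOne.charTriv hI hX).isConstantOn hY isPreconnected_connectedComponent⟩
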